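/- Let $N\ge 1$ and let $\langle\,\cdot\,\rangle$ be the average over the eigenvalues $\zeta_j=e^{i\theta_j}$, $0\le\theta_j<2\pi$, of the circular orthogonal ensemble (COE), i.e. with respect to the probability density on $[0,2\pi)^N$ proportional to $\prod_{1\le j<k\le N}|\zeta_j-\zeta_k|$. For $z\in\mathbb{C}$ with $|z|\ne 1$ put $A(z)=\sum_{j=1}^N\frac{\zeta_j+z}{\zeta_j-z}$, and define the second resolvent function (connected two-point function) $$W_2(z_1,z_2)=\langle A(z_1)A(z_2)\rangle-\langle A(z_1)\rangle\langle A(z_2)\rangle .$$ (a) For all complex $z_1,z_2$ with $|z_1|<1<|z_2|$ (the $(0,\infty)$ domain), with $\zeta=z_1/z_2$, $$\begin{aligned} W_2(z_1,z_2)={}&\frac{4\zeta^N}{1-\zeta}+\frac{4}{(1-\zeta)^2}\left[-2\zeta(1-\zeta^N)+\zeta-\zeta^N\right]\\ &+\frac{4}{N+1}\left[\frac{2\zeta^2(1-\zeta^N)}{(1-\zeta)^2}-\frac{\zeta}{1-\zeta}\bigl(N-1+(N+1)\zeta^N\bigr)\right]{}_2F_1\!\left(1,\tfrac{N+1}{2};\tfrac{N+3}{2};\zeta\right).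 \end{aligned}$$ (b) (Global large-$N$ expansion.) For every $0<\delta<1$ there is a constant $C$, depending only on $\delta$, such that for all $N\ge1$ and all complex $z_1,z_2$ with $|z_1|<1-\delta$ and $|z_2|>1+\delta$, with $\zeta=z_1/z_2$, $$\left|W_2(z_1,z_2)+8\sum_{j=0}^{9}\frac{\zeta\,P_j(\zeta)}{N^{j}(\zeta-1)^{j+2}}\right|\le \frac{C}{N^{10}},$$ where $$\begin{aligned} P_0={}&1,\qquad P_1=1+\zeta,\qquad P_2=1+4\zeta+\zeta^2,\qquad P_3=1+15\zeta+15\zeta^2+\zeta^3,\\ P_4={}&1+50\zeta+138\zeta^2+50\zeta^3+\zeta^4,\\ P_5={}&1+157\zeta+994\zeta^2+994\zeta^3+157\zeta^4+\zeta^5,\\ P_6={}&1+480\zeta+6231\zeta^2+13456\zeta^3+6231\zeta^4+480\zeta^5+\zeta^6,\\ P_7={}&1+1451\zeta+35961\zeta^2+146907\zeta^3+146907\zeta^4+35961\zeta^5+1451\zeta^6+\zeta^7,\\ P_8={}&1+4366\zeta+197224\zeta^2+1402834\zeta^3+2597230\zeta^4+1402834\zeta^5+197224\zeta^6+4366\zeta^7+\zeta^8,\\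 P_9={}&1+13113\zeta+1047252\zeta^2+12262436\zeta^3+38286798\zeta^4+38286798\zeta^5\\ &+12262436\zeta^6+1047252\zeta^7+13113\zeta^8+\zeta^9 . \end{aligned}$$ -/

import Mathlib

open MeasureTheory

namespace CircularEnsemble

noncomputable section

/-- The point `e^{iθ}` of the unit circle. -/
def unitPoint (θ : ℝ) : ℂ := Complex.exp (Complex.I * (θ : ℂ))

/-- Lebesgue measure `dθ₁ ⋯ dθ_N` on the box `[0, 2π)^N`. -/
def angleMeasure (N : ℕ) : Measure (Fin N → ℝ) :=
  volume.restrict (Set.univ.pi fun _ => Set.Ico 0 (2 * Real.pi))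

/-- The weight `∏_{j < k} |e^{iθ_j} - e^{iθ_k}|^{2κ}` of the Dyson circular ensemble with inverse
temperature `β = 2κ`. -/
def weight (N : ℕ) (κ : ℝ) (θ : Fin N → ℝ) : ℝ :=
  ∏ j : Fin N, ∏ k ∈ Finset.Ioi j, ‖unitPoint (θ j) - unitPoint (θ k)‖ ^ (2 * κ)

/-- The normalisation `Z_N`, with respect to `dθ_j / 2π = dζ_j / (2πi ζ_j)` for each particle. -/
def partitionFunction (N : ℕ) (κ : ℝ) : ℝ :=
  ((2 * Real.pi) ^ N)⁻¹ * ∫ θ, weight N κ θ ∂(angleMeasure N)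

/-- The eigenvalue probability density function, with respect to `∏_j dθ_j / 2π`. -/
def density (N : ℕ) (κ : ℝ) (θ : Fin N → ℝ) : ℝ :=
  (partitionFunction N κ)⁻¹ * weight N κ θ

/-- The ensemble average `⟨f⟩` of a function of the angles. -/
def average (N : ℕ) (κ : ℝ) (f : (Fin N → ℝ) → ℂ) : ℂ :=
  (((2 * Real.pi) ^ N)⁻¹ : ℝ) * ∫ θ, f θ * (density N κ θ : ℂ) ∂(angleMeasure N)

/-- The linear statistic `∑_j (ζ_j + z) / (ζ_j - z)`, where `ζ_j = e^{iθ_j}`. -/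
def herglotzSum (N : ℕ) (z : ℂ) (θ : Fin N → ℝ) : ℂ :=
  ∑ j : Fin N, (unitPoint (θ j) + z) / (unitPoint (θ j) - z)

/-- The first resolvent function. -/
def W₁ (N : ℕ) (κ : ℝ) (z : ℂ) : ℂ := average N κ (herglotzSum N z)

/-- The second unconnected resolvent function (mixed second moment). -/
def U₂ (N : ℕ) (κ : ℝ) (z₁ z₂ : ℂ) : ℂ :=
  average N κ fun θ => herglotzSum N z₁ θ * herglotzSum N z₂ θ

/-- The second resolvent function, that is the mixed second cumulant of the two linear statistics
(without complex conjugation). -/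
def W₂ (N : ℕ) (κ : ℝ) (z₁ z₂ : ℂ) : ℂ := U₂ N κ z₁ z₂ - W₁ N κ z₁ * W₁ N κ z₂

/-- The second resolvent function of the circular orthogonal ensemble, `β = 2κ = 1`. -/
def coeW₂ (N : ℕ) (z₁ z₂ : ℂ) : ℂ := W₂ N (1 / 2) z₁ z₂

/-- The closed form for the second resolvent function of the circular orthogonal ensemble. -/
def coeExact (N : ℕ) (ζ : ℂ) : ℂ :=
  4 * (1 - ζ)⁻¹ * ζ ^ N
    + 4 * ((1 - ζ) ^ 2)⁻¹ * (-2 * ζ * (1 - ζ ^ N) + ζ - ζ ^ N)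
    + 4 / ((N : ℂ) + 1)
      * (2 * ζ ^ 2 * ((1 - ζ) ^ 2)⁻¹ * (1 - ζ ^ N)
          - ζ * (1 - ζ)⁻¹ * ((N : ℂ) - 1 + ((N : ℂ) + 1) * ζ ^ N))
      * ordinaryHypergeometric (1 : ℂ) (((N : ℂ) + 1) / 2) (((N : ℂ) + 3) / 2) ζ

/-- The global large `N` expansion of the second resolvent function of the circular orthogonal
ensemble, truncated after the term in `N^{-9}`. -/
def coeGlobalExpansion (N : ℕ) (ζ : ℂ) : ℂ :=
  -8 * ζ / (ζ - 1) ^ 2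
  - 8 / ((N : ℂ) * (ζ - 1) ^ 3) * ζ * (1 + ζ)
  - 8 / ((N : ℂ) ^ 2 * (ζ - 1) ^ 4) * ζ * (1 + 4 * ζ + ζ ^ 2)
  - 8 / ((N : ℂ) ^ 3 * (ζ - 1) ^ 5) * ζ * (1 + 15 * ζ + 15 * ζ ^ 2 + ζ ^ 3)
  - 8 / ((N : ℂ) ^ 4 * (ζ - 1) ^ 6) * ζ * (1 + 50 * ζ + 138 * ζ ^ 2 + 50 * ζ ^ 3 + ζ ^ 4)
  - 8 / ((N : ℂ) ^ 5 * (ζ - 1) ^ 7) * ζ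
      * (1 + 157 * ζ + 994 * ζ ^ 2 + 994 * ζ ^ 3 + 157 * ζ ^ 4 + ζ ^ 5)
  - 8 / ((N : ℂ) ^ 6 * (ζ - 1) ^ 8) * ζ
      * (1 + 480 * ζ + 6231 * ζ ^ 2 + 13456 * ζ ^ 3 + 6231 * ζ ^ 4 + 480 * ζ ^ 5 + ζ ^ 6)
  - 8 / ((N : ℂ) ^ 7 * (ζ - 1) ^ 9) * ζ
      * (1 + 1451 * ζ + 35961 * ζ ^ 2 + 146907 * ζ ^ 3 + 146907 * ζ ^ 4 + 35961 * ζ ^ 5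
          + 1451 * ζ ^ 6 + ζ ^ 7)
  - 8 / ((N : ℂ) ^ 8 * (ζ - 1) ^ 10) * ζ
      * (1 + 4366 * ζ + 197224 * ζ ^ 2 + 1402834 * ζ ^ 3 + 2597230 * ζ ^ 4 + 1402834 * ζ ^ 5
          + 197224 * ζ ^ 6 + 4366 * ζ ^ 7 + ζ ^ 8)
  - 8 / ((N : ℂ) ^ 9 * (ζ - 1) ^ 11) * ζ
      * (1 + 13113 * ζ + 1047252 * ζ ^ 2 + 12262436 * ζ ^ 3 + 38286798 * ζ ^ 4
          + 38286798 * ζ ^ 5 + 12262436 * ζ ^ 6 + 1047252 * ζ ^ 7 + 13113 * ζ ^ 8 + ζ ^ 9)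

end

end CircularEnsemble

/-!
Up to a constant phase, `∏_{j<k} |ζ_j - ζ_k|` is the Vandermonde determinant in the `ζ_j`, centred
so that its exponents are symmetric about `0`, times the sign of the ordering of the angles.
Averages of exponentials are therefore combinations of Fourier coefficients of this sign.
Integrating one variable by parts against its factors `sgn (θ_j - θ_i)` merges its frequency with
that of another variable, so that only exponents which pair off to opposite values contribute;
this gives the averages of `p_k p_{-k}` for the power sums `p_k`. Expanding both Herglotz kernels
turns these into the Taylor coefficients of `W₂` in `ζ = z₁ / z₂`, and the resulting series is a
rational function of `ζ` plus a multiple of `∑ ζ^n / (N + 2n + 1)`, which is the hypergeometric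
function. Expanding its terms in powers of `1 / N` produces the series `∑ (2n + 1)^j ζ^n = E_j(ζ)
/ (1 - ζ)^(j + 1)`, where `E_j` is the Eulerian polynomial of type `B`.
-/

namespace CircularEnsemble

open Finset Filter Topology
open Complex (I)
open scoped Real

/-- The sign of a real number, with value `0` at `0`, as a complex number. -/
noncomputable def csign : ℝ →*₀ ℂ := (SignType.castHom : SignType →*₀ ℂ).comp signHom

theorem csign_of_pos {x : ℝ} (hx : 0 < x) : csign x = 1 := by
  simp [csign, sign_pos hx]

theorem csign_of_neg {x : ℝ} (hx : x < 0) : csign x = -1 := by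
  simp [csign, sign_neg hx]

theorem csign_neg (x : ℝ) : csign (-x) = -csign x := by
  rcases lt_trichotomy x 0 with h | rfl | h
  · rw [csign_of_neg h, csign_of_pos (neg_pos.2 h), neg_neg]
  · simp
  · rw [csign_of_pos h, csign_of_neg (neg_neg_of_pos h)]

theorem csign_mul_self {x : ℝ} (hx : x ≠ 0) : csign x * csign x = 1 := by
  rcases lt_or_gt_of_ne hx with h | h
  · rw [csign_of_neg h, neg_mul_neg, one_mul]
  · rw [csign_of_pos h, one_mul]

theorem norm_csign_le (x : ℝ) : ‖csign x‖ ≤ 1 := by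
  rcases lt_trichotomy x 0 with h | rfl | h
  · simp [csign_of_neg h]
  · simp
  · simp [csign_of_pos h]

theorem eventually_csign_eq {x : ℝ} (hx : x ≠ 0) : ∀ᶠ y in 𝓝 x, csign y = csign x := by
  rcases lt_or_gt_of_ne hx with h | h
  · filter_upwards [gt_mem_nhds h] with y hy
    rw [csign_of_neg h, csign_of_neg hy]
  · filter_upwards [lt_mem_nhds h] with y hy
    rw [csign_of_pos h, csign_of_pos hy]

theorem measurable_csign : Measurable csign := by
  have h : (csign : ℝ → ℂ) = fun x => if 0 < x then 1 else if x < 0 then -1 else 0 := by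
    funext x
    rcases lt_trichotomy x 0 with h | rfl | h
    · rw [csign_of_neg h, if_neg h.not_gt, if_pos h]
    · simp
    · rw [csign_of_pos h, if_pos h]
  rw [h]
  exact .ite measurableSet_Ioi measurable_const
    (.ite measurableSet_Iio measurable_const measurable_const)

theorem norm_prod_csign_le {ι : Type*} (S : Finset ι) (f : ι → ℝ) :
    ‖∏ k ∈ S, csign (f k)‖ ≤ 1 := by
  rw [norm_prod]
  exact prod_le_one (fun _ _ => norm_nonneg _) fun _ _ => norm_csign_le _

section SignPrimitive

variable {ι : Type*} {g g' : ℝ → ℂ} {S : Finset ι} {t : ι → ℝ}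

theorem intervalIntegrable_mul_prod_csign (hg : Continuous g) (S : Finset ι) (t : ι → ℝ)
    (u v : ℝ) : IntervalIntegrable (fun x => g x * ∏ k ∈ S, csign (t k - x)) volume u v := by
  refine (hg.intervalIntegrable u v (μ := volume)).mono_fun (hg.measurable.mul
    (measurable_prod S fun _ _ => measurable_csign.comp (measurable_const.sub measurable_id))
    |>.aestronglyMeasurable) (ae_of_all _ fun x => ?_)
  exact (norm_mul _ _).trans_le
    (mul_le_of_le_one_right (norm_nonneg _) (norm_prod_csign_le _ _))

theorem eventually_csign_sub_eq {a x : ℝ} (h : a ≠ x) :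
    ∀ᶠ y in 𝓝 x, csign (a - y) = csign (a - x) :=
  (continuous_const.sub continuous_id).continuousAt.eventually
    (eventually_csign_eq (sub_ne_zero.2 h))

theorem continuousAt_csign_sub {a x : ℝ} (h : a ≠ x) : ContinuousAt (fun y => csign (a - y)) x :=
  (continuousAt_congr (eventually_csign_sub_eq h)).2 continuousAt_const

theorem continuousAt_prod_csign_sub {x : ℝ} (h : ∀ k ∈ S, t k ≠ x) :
    ContinuousAt (fun y => ∏ k ∈ S, csign (t k - y)) x :=
  tendsto_finsetProd S fun k hk => continuousAt_csign_sub (h k hk)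

variable [DecidableEq ι]

/-- A primitive of `g' x * ∏ k ∈ S, csign (t k - x)`. The sum removes the jump which the function
`g x * ∏ k ∈ S, csign (t k - x)` has at each `t j`. -/
noncomputable def signPrimitive (g : ℝ → ℂ) (S : Finset ι) (t : ι → ℝ) (x : ℝ) : ℂ :=
  g x * ∏ k ∈ S, csign (t k - x)
    - ∑ j ∈ S, csign (t j - x) * (g (t j) * ∏ k ∈ S.erase j, csign (t k - t j))

theorem signPrimitive_of_lt {x : ℝ} (hx : ∀ j ∈ S, x < t j) :
    signPrimitive g S t x = g x - ∑ j ∈ S, g (t j) * ∏ k ∈ S.erase j, csign (t k - t j) := by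
  have h : ∀ j ∈ S, csign (t j - x) = 1 := fun j hj => csign_of_pos (sub_pos.2 (hx j hj))
  rw [signPrimitive, prod_congr rfl h, prod_const_one, mul_one]
  exact congrArg _ (sum_congr rfl fun j hj => by rw [h j hj, one_mul])

theorem signPrimitive_of_gt {x : ℝ} (hx : ∀ j ∈ S, t j < x) :
    signPrimitive g S t x
      = g x * (-1) ^ #S + ∑ j ∈ S, g (t j) * ∏ k ∈ S.erase j, csign (t k - t j) := by
  have h : ∀ j ∈ S, csign (t j - x) = -1 := fun j hj => csign_of_neg (sub_neg.2 (hx j hj))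
  rw [signPrimitive, prod_congr rfl h, prod_const, sub_eq_add_neg, ← sum_neg_distrib]
  exact congrArg _ (sum_congr rfl fun j hj => by rw [h j hj, neg_one_mul, neg_neg])

theorem hasDerivAt_signPrimitive {x : ℝ} (hg : HasDerivAt g (g' x) x) (hx : ∀ k ∈ S, t k ≠ x) :
    HasDerivAt (signPrimitive g S t) (g' x * ∏ k ∈ S, csign (t k - x)) x := by
  refine ((hg.mul_const (∏ k ∈ S, csign (t k - x))).sub_const
    (∑ j ∈ S, csign (t j - x) * (g (t j) * ∏ k ∈ S.erase j, csign (t k - t j))))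
    |>.congr_of_eventuallyEq ?_
  filter_upwards [(eventually_all_finset S).2 fun k hk => eventually_csign_sub_eq (hx k hk)]
    with y hy
  rw [signPrimitive, prod_congr rfl hy]
  exact congrArg _ (sum_congr rfl fun j hj => by rw [hy j hj])

theorem signPrimitive_eq_mul_sub {i : ι} (hi : i ∈ S) (x : ℝ) :
    signPrimitive g S t x = csign (t i - x) * (g x * ∏ k ∈ S.erase i, csign (t k - x)
        - g (t i) * ∏ k ∈ S.erase i, csign (t k - t i))
      - ∑ j ∈ S.erase i, csign (t j - x) * (g (t j) * ∏ k ∈ S.erase j, csign (t k - t j)) := by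
  rw [signPrimitive, ← mul_prod_erase S _ hi, ← add_sum_erase S _ hi]
  ring

theorem continuous_signPrimitive (hg : ∀ x, HasDerivAt g (g' x) x) (ht : Set.InjOn t S) :
    Continuous (signPrimitive g S t) := by
  refine continuous_iff_continuousAt.2 fun x => ?_
  by_cases hx : ∀ k ∈ S, t k ≠ x
  · exact (hasDerivAt_signPrimitive (hg x) hx).continuousAt
  push Not at hx
  obtain ⟨i, hi, rfl⟩ := hx
  have hne : ∀ k ∈ S.erase i, t k ≠ t i := fun k hk h =>
    ne_of_mem_erase hk (ht (mem_of_mem_erase hk) hi h)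
  rw [funext (signPrimitive_eq_mul_sub hi)]
  refine ContinuousAt.sub ?_ (tendsto_finsetSum _ fun j hj =>
    (continuousAt_csign_sub (hne j hj)).mul continuousAt_const)
  have hcont : ContinuousAt (fun x => g x * ∏ k ∈ S.erase i, csign (t k - x)) (t i) :=
    (hg _).continuousAt.mul (continuousAt_prod_csign_sub hne)
  rw [ContinuousAt, sub_self, sub_self, mul_zero]
  exact isBoundedUnder_le_mul_tendsto_zero (isBoundedUnder_of ⟨1, fun _ => norm_csign_le _⟩)
    (tendsto_sub_nhds_zero_iff.2 hcont)

theorem integral_deriv_mul_prod_csign (hg : ∀ x, HasDerivAt g (g' x) x) (hg' : Continuous g')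
    (ht : Set.InjOn t S) (u v : ℝ) :
    ∫ x in u..v, g' x * ∏ k ∈ S, csign (t k - x)
      = signPrimitive g S t v - signPrimitive g S t u :=
  integral_eq_of_hasDerivAt_off_countable _ _ (S.finite_toSet.image t).countable
    (continuous_signPrimitive hg ht).continuousOn
    (fun x hx => hasDerivAt_signPrimitive (hg x) fun _ hk h => hx.2 ⟨_, hk, h⟩)
    (intervalIntegrable_mul_prod_csign hg' S t u v)

end SignPrimitive

/-- Lebesgue measure on the open box `(0, 2π)^n`. It equals `angleMeasure n`, and its product form
makes Fubini's theorem available. -/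
noncomputable def boxMeasure (n : ℕ) : Measure (Fin n → ℝ) :=
  Measure.pi fun _ => volume.restrict (Set.Ioo 0 (2 * π))

instance (n : ℕ) : IsFiniteMeasure (boxMeasure n) := by
  unfold boxMeasure; infer_instance

theorem angleMeasure_eq (N : ℕ) : angleMeasure N = boxMeasure N := by
  rw [angleMeasure, boxMeasure, volume_pi, Measure.restrict_pi_pi]
  exact congrArg _ (funext fun _ => (Measure.restrict_congr_set Ioo_ae_eq_Ico).symm)

theorem ae_boxMeasure (n : ℕ) : ∀ᵐ θ ∂(boxMeasure n), ∀ j, θ j ∈ Set.Ioo 0 (2 * π) := by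
  rw [boxMeasure, ← Measure.restrict_pi_pi]
  filter_upwards [ae_restrict_mem (MeasurableSet.univ_pi fun _ => measurableSet_Ioo)] with θ hθ j
  exact hθ j (Set.mem_univ j)

theorem integral_boxMeasure_perm {n : ℕ} (σ : Equiv.Perm (Fin n)) (f : (Fin n → ℝ) → ℂ) :
    ∫ θ, f (fun j => θ (σ j)) ∂(boxMeasure n) = ∫ θ, f θ ∂(boxMeasure n) := by
  have h := (measurePreserving_piCongrLeft
    (fun _ : Fin n => (volume : Measure ℝ).restrict (Set.Ioo 0 (2 * π))) σ.symm).integral_comp'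
    (g := f)
  rw [boxMeasure, ← h]
  refine integral_congr_ae (ae_of_all _ fun θ => congrArg f (funext fun j => ?_))
  simpa using (MeasurableEquiv.piCongrLeft_apply_apply (β := fun _ : Fin n => ℝ) (e := σ.symm)
    (x := θ) (i := σ j)).symm

theorem integral_boxMeasure_insertNth {n : ℕ} (i : Fin (n + 1)) {f : (Fin (n + 1) → ℝ) → ℂ}
    (hf : Integrable f (boxMeasure (n + 1))) :
    ∫ θ, f θ ∂(boxMeasure (n + 1))
      = ∫ t, (∫ x in Set.Ioo 0 (2 * π), f (i.insertNth x t)) ∂(boxMeasure n) := by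
  have h := (measurePreserving_piFinSuccAbove
    (fun _ : Fin (n + 1) => (volume : Measure ℝ).restrict (Set.Ioo 0 (2 * π))) i).symm
  unfold boxMeasure at hf ⊢
  rw [← h.integral_comp' (g := f)]
  exact integral_prod_symm _
    ((h.integrable_comp_emb (MeasurableEquiv.measurableEmbedding _) (g := f)).2 hf)

theorem integrable_boxMeasure_of_bound {n : ℕ} {f : (Fin n → ℝ) → ℂ} (hf : Measurable f) {C : ℝ}
    (hC : ∀ θ, ‖f θ‖ ≤ C) : Integrable f (boxMeasure n) :=
  .of_bound hf.aestronglyMeasurable C (ae_of_all _ hC)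

/-- The function `e^{imx/2}`. Half-integer frequencies occur in the modulus of a Vandermonde
product of even size. -/
noncomputable def halfExp (m : ℤ) (x : ℝ) : ℂ := Complex.exp (I * m / 2 * x)

theorem halfExp_add (m l : ℤ) (x : ℝ) : halfExp (m + l) x = halfExp m x * halfExp l x := by
  rw [halfExp, halfExp, halfExp, ← Complex.exp_add]
  congr 1
  push_cast
  ring

@[simp] theorem halfExp_zero (x : ℝ) : halfExp 0 x = 1 := by simp [halfExp]

@[simp] theorem halfExp_apply_zero (m : ℤ) : halfExp m 0 = 1 := by simp [halfExp]

theorem halfExp_two_pi (m : ℤ) : halfExp m (2 * π) = (-1) ^ m := by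
  rw [halfExp, ← Complex.exp_pi_mul_I, ← Complex.exp_int_mul]
  congr 1
  push_cast
  ring

theorem norm_halfExp (m : ℤ) (x : ℝ) : ‖halfExp m x‖ = 1 := by
  rw [halfExp, show I * m / 2 * x = ((m / 2 * x : ℝ) : ℂ) * I by push_cast; ring]
  exact Complex.norm_exp_ofReal_mul_I _

theorem continuous_halfExp (m : ℤ) : Continuous (halfExp m) := by
  unfold halfExp; fun_prop

theorem hasDerivAt_halfExp {m : ℤ} (hm : m ≠ 0) (x : ℝ) :
    HasDerivAt (fun x => 2 / (I * m) * halfExp m x) (halfExp m x) x := by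
  have hm' : (m : ℂ) ≠ 0 := by exact_mod_cast hm
  have h : HasDerivAt (fun x : ℝ => I * m / 2 * (x : ℂ)) (I * m / 2 * 1) x :=
    Complex.ofRealCLM.hasDerivAt.const_mul _
  refine (h.cexp.const_mul (2 / (I * m))).congr_deriv ?_
  rw [halfExp]
  field_simp [Complex.I_ne_zero]

theorem integral_halfExp_of_even {m : ℤ} (hm : Even m) :
    ∫ x in Set.Ioo 0 (2 * π), halfExp m x = if m = 0 then 2 * (π : ℂ) else 0 := by
  rw [← integral_Ioc_eq_integral_Ioo, ← intervalIntegral.integral_of_le Real.two_pi_pos.le]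
  split_ifs with h
  · subst h; simp
  · rw [intervalIntegral.integral_eq_sub_of_hasDerivAt (fun x _ => hasDerivAt_halfExp h x)
      ((continuous_halfExp m).intervalIntegrable _ _), halfExp_two_pi, halfExp_apply_zero,
      hm.neg_one_zpow, sub_self]

theorem measurable_prod_halfExp {n : ℕ} (p : Fin n → ℤ) :
    Measurable fun θ : Fin n → ℝ => ∏ j, halfExp (p j) (θ j) :=
  measurable_prod _ fun j _ => (continuous_halfExp _).measurable.comp (measurable_pi_apply j)

theorem norm_prod_halfExp {n : ℕ} (p : Fin n → ℤ) (θ : Fin n → ℝ) :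
    ‖∏ j, halfExp (p j) (θ j)‖ = 1 := by
  simp [norm_prod, norm_halfExp]

/-- The sign of the permutation which sorts `θ`, zero if two entries coincide. -/
noncomputable def ordSign {n : ℕ} (θ : Fin n → ℝ) : ℂ :=
  ∏ j : Fin n, ∏ k ∈ Ioi j, csign (θ k - θ j)

theorem ordSign_eq {n : ℕ} (θ : Fin n → ℝ) : ordSign θ = csign (Matrix.vandermonde θ).det := by
  simp only [ordSign, Matrix.det_vandermonde, map_prod]

theorem ordSign_perm {n : ℕ} (σ : Equiv.Perm (Fin n)) (θ : Fin n → ℝ) :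
    ordSign (fun j => θ (σ j)) = ((Equiv.Perm.sign σ : ℤ) : ℂ) * ordSign θ := by
  have hσ : Matrix.vandermonde (fun j => θ (σ j)) = (Matrix.vandermonde θ).submatrix σ id := rfl
  rw [ordSign_eq, ordSign_eq, hσ, Matrix.det_permute, map_mul]
  rcases Int.units_eq_one_or (Equiv.Perm.sign σ) with h | h <;> simp [h, csign_neg]

theorem ordSign_cons {n : ℕ} (x : ℝ) (t : Fin n → ℝ) :
    ordSign (Fin.cons x t : Fin (n + 1) → ℝ) = (∏ k, csign (t k - x)) * ordSign t := by
  rw [ordSign, Fin.prod_univ_succ, Fin.Ioi_zero_eq_map, prod_map]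
  refine congrArg _ (prod_congr rfl fun j _ => ?_)
  rw [Fin.Ioi_succ, prod_map]
  rfl

theorem ordSign_insertNth {n : ℕ} (i : Fin (n + 1)) (x : ℝ) (t : Fin n → ℝ) :
    ordSign (i.insertNth x t : Fin (n + 1) → ℝ)
      = (-1) ^ (i : ℕ) * (∏ k, csign (t k - x)) * ordSign t := by
  have h := ordSign_perm i.cycleRange.symm (i.insertNth x t : Fin (n + 1) → ℝ)
  have hcons : (fun j => (i.insertNth x t : Fin (n + 1) → ℝ) (i.cycleRange.symm j))
      = Fin.cons x t := Fin.insertNth_comp_cycleRange_symm i x t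
  rw [hcons, ordSign_cons, Equiv.Perm.sign_symm, Fin.sign_cycleRange] at h
  push_cast at h
  rw [mul_assoc, h, ← mul_assoc, ← mul_pow]
  simp

theorem measurable_ordSign {n : ℕ} : Measurable (ordSign : (Fin n → ℝ) → ℂ) :=
  measurable_prod _ fun j _ => measurable_prod _ fun k _ =>
    measurable_csign.comp ((measurable_pi_apply k).sub (measurable_pi_apply j))

theorem norm_ordSign_le {n : ℕ} (θ : Fin n → ℝ) : ‖ordSign θ‖ ≤ 1 := by
  rw [ordSign_eq]; exact norm_csign_le _

theorem injective_of_ordSign_ne_zero {n : ℕ} {θ : Fin n → ℝ} (h : ordSign θ ≠ 0) :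
    Function.Injective θ := by
  rw [← Matrix.det_vandermonde_ne_zero_iff]
  exact fun h0 => h (by rw [ordSign_eq, h0, map_zero])

/-- The Fourier coefficients of `ordSign`. -/
noncomputable def signFourier {n : ℕ} (p : Fin n → ℤ) : ℂ :=
  ∫ θ, (∏ j, halfExp (p j) (θ j)) * ordSign θ ∂(boxMeasure n)

theorem integrable_prod_halfExp_mul_ordSign {n : ℕ} (p : Fin n → ℤ) :
    Integrable (fun θ => (∏ j, halfExp (p j) (θ j)) * ordSign θ) (boxMeasure n) := by
  refine integrable_boxMeasure_of_bound ((measurable_prod_halfExp p).mul measurable_ordSign)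
    (C := 1) fun θ => ?_
  rw [norm_mul, norm_prod_halfExp, one_mul]
  exact norm_ordSign_le θ

theorem signFourier_perm {n : ℕ} (σ : Equiv.Perm (Fin n)) (p : Fin n → ℤ) :
    signFourier (fun j => p (σ j)) = ((Equiv.Perm.sign σ : ℤ) : ℂ) * signFourier p := by
  rw [signFourier, signFourier, ← integral_boxMeasure_perm σ, ← integral_const_mul]
  refine integral_congr_ae (ae_of_all _ fun θ => ?_)
  simp only [ordSign_perm, Equiv.prod_comp σ (fun j => halfExp (p j) (θ j))]
  ring

theorem signFourier_comp_swap {n : ℕ} (p : Fin n → ℤ) {a b : Fin n} (h : a ≠ b) :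
    signFourier (fun j => p (Equiv.swap a b j)) = -signFourier p := by
  simp [signFourier_perm, Equiv.Perm.sign_swap h]

theorem signFourier_eq_zero_of_not_injective {n : ℕ} {p : Fin n → ℤ}
    (hp : ¬Function.Injective p) : signFourier p = 0 := by
  simp only [Function.Injective, not_forall] at hp
  obtain ⟨a, b, hab, hne⟩ := hp
  have h := signFourier_comp_swap p hne
  rwa [show (fun j => p (Equiv.swap a b j)) = p from funext fun j => by grind,
    self_eq_neg] at h

theorem integral_halfExp_mul_prod_csign {n : ℕ} {m : ℤ} (hm : m ≠ 0) (hpar : Even (m + n))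
    {t : Fin n → ℝ} (ht : Function.Injective t) (htI : ∀ j, t j ∈ Set.Ioo 0 (2 * π)) :
    ∫ x in Set.Ioo 0 (2 * π), halfExp m x * ∏ k, csign (t k - x)
      = 4 / (I * m) * ∑ j, halfExp m (t j) * ∏ k ∈ univ.erase j, csign (t k - t j) := by
  have hsign : ((-1 : ℂ)) ^ m * (-1) ^ n = 1 := by
    rw [← zpow_natCast, ← zpow_add₀ (by norm_num), hpar.neg_one_zpow]
  rw [← integral_Ioc_eq_integral_Ioo, ← intervalIntegral.integral_of_le Real.two_pi_pos.le,
    integral_deriv_mul_prod_csign (hasDerivAt_halfExp hm) (continuous_halfExp m) ht.injOn,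
    signPrimitive_of_lt fun j _ => (htI j).1, signPrimitive_of_gt fun j _ => (htI j).2,
    halfExp_two_pi, halfExp_apply_zero, card_univ, Fintype.card_fin]
  simp only [mul_assoc (2 / (I * (m : ℂ))), ← mul_sum]
  linear_combination (2 / (I * m)) * hsign

/-- The integrand which arises from that of `signFourier` when a variable of frequency `m` is
integrated out and the boundary term at the `j`-th remaining variable is kept: the removed variable
is then set equal to `t j`. -/
noncomputable def mergedIntegrand {n : ℕ} (m : ℤ) (q : Fin n → ℤ) (j : Fin n) (t : Fin n → ℝ) : ℂ :=
  halfExp m (t j) * (∏ k ∈ univ.erase j, csign (t k - t j))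
    * ((∏ k, halfExp (q k) (t k)) * ordSign t)

theorem integrable_mergedIntegrand {n : ℕ} (m : ℤ) (q : Fin n → ℤ) (j : Fin n) :
    Integrable (mergedIntegrand m q j) (boxMeasure n) := by
  refine integrable_boxMeasure_of_bound (C := 1) ?_ fun t => ?_
  · exact (((continuous_halfExp _).measurable.comp (measurable_pi_apply j)).mul
      (measurable_prod _ fun k _ => measurable_csign.comp
        ((measurable_pi_apply k).sub (measurable_pi_apply j)))).mul
      ((measurable_prod_halfExp _).mul measurable_ordSign)
  · simp only [mergedIntegrand, norm_mul, norm_halfExp, norm_prod_halfExp, one_mul]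
    exact mul_le_one₀ (norm_prod_csign_le _ _) (norm_nonneg _) (norm_ordSign_le t)

theorem signFourier_eq_sum_integral_mergedIntegrand {n : ℕ} (p : Fin (n + 1) → ℤ) {i : Fin (n + 1)}
    (hi : p i ≠ 0) (hpar : Even (p i + n)) :
    signFourier p = 4 / (I * p i) * (-1) ^ (i : ℕ)
      * ∑ j, ∫ t, mergedIntegrand (p i) (i.removeNth p) j t ∂(boxMeasure n) := by
  rw [signFourier, integral_boxMeasure_insertNth i (integrable_prod_halfExp_mul_ordSign p),
    ← integral_finsetSum _ fun j _ => integrable_mergedIntegrand _ _ j, ← integral_const_mul]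
  refine integral_congr_ae ?_
  filter_upwards [ae_boxMeasure n] with t ht
  have hsplit : ∀ x : ℝ, (∏ j, halfExp (p j) ((i.insertNth x t : Fin (n + 1) → ℝ) j))
      * ordSign (i.insertNth x t : Fin (n + 1) → ℝ)
      = halfExp (p i) x * (∏ k, csign (t k - x))
        * ((-1) ^ (i : ℕ) * ((∏ k, halfExp (i.removeNth p k) (t k)) * ordSign t)) := by
    intro x
    rw [ordSign_insertNth, Fin.prod_univ_succAbove _ i]
    simp only [Fin.insertNth_apply_same, Fin.insertNth_apply_succAbove, Fin.removeNth_apply]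
    ring
  simp only [hsplit, integral_mul_const]
  by_cases hs : ordSign t = 0
  · simp [mergedIntegrand, hs]
  · rw [integral_halfExp_mul_prod_csign hi hpar (injective_of_ordSign_ne_zero hs) ht]
    simp only [mergedIntegrand]
    rw [← sum_mul]
    ring

theorem univ_erase_eq_map_succAboveEmb {n : ℕ} (j : Fin (n + 1)) :
    univ.erase j = univ.map (Fin.succAboveEmb j) := by
  ext k
  simp [Fin.exists_succAbove_eq_iff]

theorem mergedIntegrand_insertNth {n : ℕ} (m : ℤ) (q : Fin (n + 1) → ℤ) (j : Fin (n + 1))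
    {t : Fin n → ℝ} {x : ℝ} (hx : ∀ k, t k ≠ x) :
    mergedIntegrand m q j (j.insertNth x t) = halfExp (m + q j) x
      * ((-1) ^ (j : ℕ) * ((∏ k, halfExp (j.removeNth q k) (t k)) * ordSign t)) := by
  have hsq : (∏ k, csign (t k - x)) * (∏ k, csign (t k - x)) = 1 := by
    rw [← prod_mul_distrib]
    exact prod_eq_one fun k _ => csign_mul_self (sub_ne_zero.2 (hx k))
  rw [mergedIntegrand, univ_erase_eq_map_succAboveEmb, prod_map, ordSign_insertNth,
    Fin.prod_univ_succAbove _ j, halfExp_add]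
  simp only [Fin.insertNth_apply_same, Fin.insertNth_apply_succAbove, Fin.succAboveEmb_apply,
    Fin.removeNth_apply]
  linear_combination (halfExp m x * halfExp (q j) x * (-1) ^ (j : ℕ)
    * ((∏ k, halfExp (q (j.succAbove k)) (t k)) * ordSign t)) * hsq

theorem integral_mergedIntegrand {n : ℕ} {m : ℤ} {q : Fin (n + 1) → ℤ} {j : Fin (n + 1)}
    (hpar : Even (m + q j)) :
    ∫ t, mergedIntegrand m q j t ∂(boxMeasure (n + 1)) =
      if m + q j = 0 then 2 * π * ((-1) ^ (j : ℕ) * signFourier (j.removeNth q)) else 0 := by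
  have hinner : ∀ t : Fin n → ℝ,
      ∫ x in Set.Ioo 0 (2 * π), mergedIntegrand m q j (j.insertNth x t)
        = (∫ x in Set.Ioo 0 (2 * π), halfExp (m + q j) x)
          * ((-1) ^ (j : ℕ) * ((∏ k, halfExp (j.removeNth q k) (t k)) * ordSign t)) := by
    intro t
    rw [← integral_mul_const]
    refine integral_congr_ae (ae_restrict_of_ae ?_)
    filter_upwards [compl_mem_ae_iff.2 ((Set.finite_range t).measure_zero volume)] with x hx
    exact mergedIntegrand_insertNth m q j fun k h => hx ⟨k, h⟩
  rw [integral_boxMeasure_insertNth j (integrable_mergedIntegrand m q j)]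
  simp only [hinner, integral_const_mul, integral_halfExp_of_even hpar, signFourier]
  split_ifs <;> simp

theorem signFourier_eq_zero_of_no_partner {n : ℕ} {p : Fin n → ℤ} (hpar : ∀ j, Odd (p j + n))
    {a : Fin n} (ha : p a ≠ 0) (h : ∀ j, p a + p j ≠ 0) : signFourier p = 0 := by
  obtain _ | n := n
  · exact a.elim0
  rw [signFourier_eq_sum_integral_mergedIntegrand p ha (by have := hpar a; grind),
    sum_eq_zero, mul_zero]
  intro j _
  obtain _ | n := n
  · exact j.elim0
  rw [integral_mergedIntegrand (by
    have := hpar a; have := hpar (a.succAbove j); simp only [Fin.removeNth_apply]; grind)]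
  exact if_neg (h _)

theorem mul_signFourier_of_partner {n : ℕ} {p : Fin (n + 2) → ℤ}
    (hpar : ∀ j, Odd (p j + (n + 2 : ℕ))) (hinj : Function.Injective p) {a : Fin (n + 2)}
    {b : Fin (n + 1)} (ha : p a ≠ 0) (hb : p (a.succAbove b) = -p a) :
    (p a : ℂ) * signFourier p = 8 * π / I * ((-1) ^ (a : ℕ) * (-1) ^ (b : ℕ)
      * signFourier (b.removeNth (a.removeNth p))) := by
  have haC : (p a : ℂ) ≠ 0 := by exact_mod_cast ha
  have hterm : ∀ j, ∫ t, mergedIntegrand (p a) (a.removeNth p) j t ∂(boxMeasure (n + 1)) =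
      if p a + p (a.succAbove j) = 0 then
        2 * π * ((-1) ^ (j : ℕ) * signFourier (j.removeNth (a.removeNth p))) else 0 := fun j =>
    integral_mergedIntegrand (by
      have := hpar a; have := hpar (a.succAbove j); simp only [Fin.removeNth_apply]; grind)
  rw [signFourier_eq_sum_integral_mergedIntegrand p ha (by have := hpar a; grind),
    sum_eq_single b, hterm, if_pos (by rw [hb, add_neg_cancel])]
  · field_simp
    ring
  · intro j _ hj
    rw [hterm, if_neg]
    intro h
    exact hj (Fin.succAbove_right_injective (hinj (by rw [hb]; linarith)))
  · exact fun h => absurd (mem_univ _) h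

theorem signFourier_replace_pair {n : ℕ} {p q : Fin n → ℤ} (hp : ∀ j, Odd (p j + n))
    (hq : ∀ j, Odd (q j + n)) (hpi : Function.Injective p) (hqi : Function.Injective q)
    {a b : Fin n} (hab : a ≠ b) (hpa : p a ≠ 0) (hqa : q a ≠ 0) (hpb : p b = -p a)
    (hqb : q b = -q a) (hpq : ∀ j, j ≠ a → j ≠ b → p j = q j) :
    (p a : ℂ) * signFourier p = q a * signFourier q := by
  match n, p, q, a, b with
  | 1, _, _, a, b => exact absurd (Subsingleton.elim a b) hab
  | n + 2, p, q, a, b =>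
    obtain ⟨b, rfl⟩ := Fin.exists_succAbove_eq hab.symm
    have hrest : b.removeNth (a.removeNth p) = b.removeNth (a.removeNth q) := funext fun k =>
      hpq _ (Fin.succAbove_ne _ _) fun h =>
        Fin.succAbove_ne _ _ (Fin.succAbove_right_injective h)
    rw [mul_signFourier_of_partner hp hpi hpa hpb, mul_signFourier_of_partner hq hqi hqa hqb, hrest]

theorem sum_eq_zero_of_signFourier_ne_zero {n : ℕ} {p : Fin n → ℤ} (hpar : ∀ j, Odd (p j + n))
    (h : signFourier p ≠ 0) : ∑ j, p j = 0 := by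
  have hinj : Function.Injective p := by
    by_contra hc
    exact h (signFourier_eq_zero_of_not_injective hc)
  have hpart : ∀ a, ∃ j, p j = -p a := by
    intro a
    by_contra! hc
    have ha : p a ≠ 0 := fun h0 => hc a (by rw [h0, neg_zero])
    exact h (signFourier_eq_zero_of_no_partner hpar ha fun j hj => hc j (by linarith))
  rw [← sum_image (s := univ) (f := fun x : ℤ => x) (g := p) hinj.injOn]
  refine sum_involution (fun x _ => -x) (fun x _ => add_neg_cancel x) (fun x _ hx => by omega)
    (fun x hx => ?_) fun x _ => neg_neg x
  obtain ⟨a, _, rfl⟩ := mem_image.1 hx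
  obtain ⟨j, hj⟩ := hpart a
  exact mem_image.2 ⟨j, mem_univ _, hj⟩

/-- The doubled exponents `-(N - 1), -(N - 3), …, N - 1` of the diagonal term of the
antisymmetrised Vandermonde product. -/
def baseExp (N : ℕ) (j : Fin N) : ℤ := 2 * (j : ℤ) + 1 - N

theorem odd_baseExp_add (N : ℕ) (j : Fin N) : Odd (baseExp N j + N) :=
  ⟨j, by unfold baseExp; ring⟩

theorem baseExp_injective (N : ℕ) : Function.Injective (baseExp N) := by
  intro i j h
  unfold baseExp at h
  ext
  omega

theorem baseExp_rev {N : ℕ} (j : Fin N) : baseExp N j.rev = -baseExp N j := by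
  simp only [baseExp, Fin.val_rev]
  omega

theorem sum_baseExp (N : ℕ) : ∑ j, baseExp N j = 0 := by
  have h := Equiv.sum_comp Fin.revPerm (baseExp N)
  simp only [Fin.revPerm_apply, baseExp_rev, sum_neg_distrib] at h
  exact neg_eq_self.1 h

/-- The exponents which arise from `baseExp N` when the integrand is multiplied by
`e^{ikθ_a} e^{-ilθ_b}`. -/
def shiftExp (N : ℕ) (k l : ℤ) (a b : Fin N) : Fin N → ℤ :=
  baseExp N + Pi.single a (2 * k) - Pi.single b (2 * l)

theorem shiftExp_apply {N : ℕ} (k l : ℤ) (a b j : Fin N) : shiftExp N k l a b j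
    = 2 * (j : ℤ) + 1 - N + (if j = a then 2 * k else 0) - if j = b then 2 * l else 0 := by
  simp [shiftExp, Pi.single_apply, baseExp]

theorem odd_shiftExp_add {N : ℕ} (k l : ℤ) (a b j : Fin N) : Odd (shiftExp N k l a b j + N) := by
  have := odd_baseExp_add N j
  rw [shiftExp_apply]
  split_ifs <;> grind

theorem signFourier_shiftExp_of_ne {N : ℕ} {k l : ℤ} (hkl : k ≠ l) (a b : Fin N) :
    signFourier (shiftExp N k l a b) = 0 := by
  by_contra h
  have hsum := sum_eq_zero_of_signFourier_ne_zero (odd_shiftExp_add k l a b) h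
  simp only [shiftExp, Pi.sub_apply, Pi.add_apply, sum_sub_distrib, sum_add_distrib, sum_baseExp,
    Fintype.sum_pi_single'] at hsum
  omega

theorem shiftExp_self {N : ℕ} (k : ℤ) (a : Fin N) : shiftExp N k k a a = baseExp N := by
  simp [shiftExp]

theorem shiftExp_eq_baseExp_swap {N : ℕ} {k : ℤ} {a c : Fin N} (hc : (c : ℤ) = a + k) :
    shiftExp N k k a c = fun j => baseExp N (Equiv.swap a c j) := by
  funext j
  rw [shiftExp_apply, baseExp]
  rcases eq_or_ne j a with rfl | hja
  · grind [Equiv.swap_apply_left]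
  rcases eq_or_ne j c with rfl | hjc
  · grind [Equiv.swap_apply_right]
  · rw [Equiv.swap_apply_of_ne_of_ne hja hjc, if_neg hja, if_neg hjc]
    ring

theorem sum_signFourier_shiftExp_of_lt {N k : ℕ} (hk : 1 ≤ k) {a : Fin N} (hak : a + k < N) :
    ∑ b, signFourier (shiftExp N k k a b) = 0 := by
  obtain ⟨c, hc⟩ : ∃ c : Fin N, (c : ℕ) = a + k := ⟨⟨a + k, hak⟩, rfl⟩
  have hac : a ≠ c := fun h => by have := congrArg Fin.val h; omega
  rw [sum_eq_add a c hac ?_ (fun h => absurd (mem_univ _) h) (fun h => absurd (mem_univ _) h),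
    shiftExp_self, shiftExp_eq_baseExp_swap (by exact_mod_cast hc), signFourier_comp_swap _ hac,
    add_neg_cancel]
  rintro b - ⟨hba, hbc⟩
  refine signFourier_eq_zero_of_not_injective fun hinj => hac (hinj ?_)
  rw [shiftExp_apply, shiftExp_apply, if_pos rfl, if_neg hba.symm, if_neg hac.symm, if_neg hbc.symm]
  omega

theorem signFourier_shiftExp_of_ne_rev {N k : ℕ} {a b : Fin N} (hak : N ≤ a + k) (hba : b ≠ a)
    (hbr : b ≠ a.rev) : signFourier (shiftExp N k k a b) = 0 := by
  have hbr' : (b : ℕ) ≠ N - (a + 1) := fun h => hbr (Fin.ext (by rw [h, Fin.val_rev]))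
  refine signFourier_eq_zero_of_no_partner (odd_shiftExp_add _ _ a b) (a := a) ?_ fun j => ?_
  all_goals simp only [shiftExp_apply, if_pos, if_neg hba.symm]
  · omega
  · split_ifs with hja hjb <;> omega

theorem mul_signFourier_shiftExp_rev {N k : ℕ} {a : Fin N} (hak : N ≤ a + k) (ha : a.rev ≠ a) :
    ((baseExp N a : ℂ) + 2 * k) * signFourier (shiftExp N k k a a.rev)
      = baseExp N a * signFourier (baseExp N) := by
  have hrev := Fin.val_rev a
  have hne : (a.rev : ℕ) ≠ a := fun h => ha (Fin.ext h)
  have hshift : shiftExp N k k a a.rev a = baseExp N a + 2 * k := by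
    simp [shiftExp, ha.symm]
  have h := signFourier_replace_pair (a := a) (b := a.rev) (odd_shiftExp_add k k a a.rev)
    (odd_baseExp_add N) ?_ (baseExp_injective N) ha.symm ?_ ?_ ?_ (baseExp_rev a) ?_
  · rw [hshift] at h
    exact_mod_cast h
  · intro i j hij
    simp only [shiftExp_apply, Fin.ext_iff] at hij ⊢
    split_ifs at hij <;> omega
  · rw [hshift, baseExp]; omega
  · rw [baseExp]; omega
  · rw [hshift, shiftExp_apply, if_neg ha, if_pos rfl, baseExp]; omega
  · intro j hja hjr
    simp [shiftExp, hja, hjr]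

theorem sum_signFourier_shiftExp_of_le {N k : ℕ} {a : Fin N} (hak : N ≤ a + k) :
    ∑ b, signFourier (shiftExp N k k a b)
      = signFourier (baseExp N) * (1 + (baseExp N a : ℂ) / (baseExp N a + 2 * k)) := by
  have hnot (i : Fin N) : i ∉ univ → signFourier (shiftExp N k k a i) = 0 :=
    fun h => absurd (mem_univ _) h
  by_cases ha : a.rev = a
  · have hbase : baseExp N a = 0 := by have := baseExp_rev a; rw [ha] at this; omega
    rw [sum_eq_single a (fun b _ hb => signFourier_shiftExp_of_ne_rev hak hb (by rwa [ha]))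
      (hnot a), shiftExp_self, hbase]
    simp
  · have hpos : (baseExp N a : ℂ) + 2 * k ≠ 0 := by
      have : baseExp N a + 2 * k ≠ 0 := by unfold baseExp; omega
      exact_mod_cast this
    rw [sum_eq_add a a.rev (Ne.symm ha)
      (fun b _ hb => signFourier_shiftExp_of_ne_rev hak hb.1 hb.2) (hnot a) (hnot _), shiftExp_self]
    field_simp
    linear_combination mul_signFourier_shiftExp_rev hak ha

theorem sum_signFourier_shiftExp {N k : ℕ} (hk : 1 ≤ k) (a : Fin N) :
    ∑ b, signFourier (shiftExp N k k a b) = signFourier (baseExp N)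
      * if N ≤ a + k then 1 + (baseExp N a : ℂ) / (baseExp N a + 2 * k) else 0 := by
  split_ifs with hak
  · exact sum_signFourier_shiftExp_of_le hak
  · rw [sum_signFourier_shiftExp_of_lt hk (not_le.1 hak), mul_zero]

theorem unitPoint_pow (x : ℝ) (m : ℕ) : unitPoint x ^ m = halfExp (2 * m) x := by
  rw [unitPoint, halfExp, ← Complex.exp_nat_mul]
  congr 1
  push_cast
  ring

theorem unitPoint_eq (x : ℝ) : unitPoint x = halfExp 2 x := by
  simpa using unitPoint_pow x 1

theorem unitPoint_inv (x : ℝ) : (unitPoint x)⁻¹ = halfExp (-2) x := by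
  refine inv_eq_of_mul_eq_one_right ?_
  rw [unitPoint_eq, ← halfExp_add, add_neg_cancel, halfExp_zero]

theorem norm_unitPoint (x : ℝ) : ‖unitPoint x‖ = 1 := by
  rw [unitPoint_eq, norm_halfExp]

theorem continuous_unitPoint : Continuous unitPoint := by
  unfold unitPoint; fun_prop

theorem unitPoint_injOn : Set.InjOn unitPoint (Set.Ioc (-π) π) := fun x hx y hy h => by
  have hI : I * (x : ℂ) = I * y :=
    Complex.exp_inj_of_neg_pi_lt_of_le_pi (by simpa using hx.1) (by simpa using hx.2)
      (by simpa using hy.1) (by simpa using hy.2) h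
  simpa using hI

section Average

variable {N : ℕ} {κ : ℝ}

theorem weight_nonneg (θ : Fin N → ℝ) : 0 ≤ weight N κ θ :=
  prod_nonneg fun _ _ => prod_nonneg fun _ _ => Real.rpow_nonneg (norm_nonneg _) _

theorem continuous_weight (hκ : 0 ≤ κ) : Continuous (weight N κ) :=
  continuous_finsetProd _ fun j _ => continuous_finsetProd _ fun k _ =>
    ((continuous_unitPoint.comp (continuous_apply j)).sub
      (continuous_unitPoint.comp (continuous_apply k))).norm.rpow_const fun _ =>
        Or.inr (by positivity)

theorem weight_le (hκ : 0 ≤ κ) (θ : Fin N → ℝ) :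
    weight N κ θ ≤ ∏ j : Fin N, ∏ _k ∈ Ioi j, (2 : ℝ) ^ (2 * κ) := by
  refine prod_le_prod (fun _ _ => prod_nonneg fun _ _ => Real.rpow_nonneg (norm_nonneg _) _)
    fun j _ => prod_le_prod (fun _ _ => Real.rpow_nonneg (norm_nonneg _) _) fun k _ =>
      Real.rpow_le_rpow (norm_nonneg _) ?_ (by positivity)
  calc ‖unitPoint (θ j) - unitPoint (θ k)‖ ≤ ‖unitPoint (θ j)‖ + ‖unitPoint (θ k)‖ :=
        norm_sub_le _ _
    _ = 2 := by rw [norm_unitPoint, norm_unitPoint]; norm_num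

theorem integrable_mul_weight (hκ : 0 ≤ κ) {f : (Fin N → ℝ) → ℂ} (hf : Measurable f) {C : ℝ}
    (hC : ∀ θ, ‖f θ‖ ≤ C) :
    Integrable (fun θ => f θ * (weight N κ θ : ℂ)) (boxMeasure N) := by
  refine integrable_boxMeasure_of_bound (hf.mul (Complex.measurable_ofReal.comp
    (continuous_weight hκ).measurable)) (C := C * ∏ j : Fin N, ∏ _k ∈ Ioi j, (2 : ℝ) ^ (2 * κ))
    fun θ => ?_
  rw [norm_mul, Complex.norm_real, Real.norm_of_nonneg (weight_nonneg θ)]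
  exact mul_le_mul (hC θ) (weight_le hκ θ) (weight_nonneg θ) ((norm_nonneg _).trans (hC θ))

theorem exists_weight_ne_zero (N : ℕ) (κ : ℝ) :
    ∃ θ ∈ Set.univ.pi fun _ : Fin N => Set.Ioo 0 (2 * π), weight N κ θ ≠ 0 := by
  have hpos (j : Fin N) : 0 < ((j : ℝ) + 1)⁻¹ := by positivity
  have hle (j : Fin N) : ((j : ℝ) + 1)⁻¹ ≤ 1 := inv_le_one_of_one_le₀ (by simp)
  have hπ := Real.pi_gt_three
  have hmem (j : Fin N) : ((j : ℝ) + 1)⁻¹ ∈ Set.Ioc (-π) π :=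
    ⟨by linarith [hpos j], by linarith [hle j]⟩
  refine ⟨fun j => ((j : ℝ) + 1)⁻¹, fun j _ => ⟨hpos j, by linarith [hle j]⟩, ?_⟩
  refine prod_ne_zero_iff.2 fun j _ => prod_ne_zero_iff.2 fun k hk =>
    (Real.rpow_pos_of_pos (norm_pos_iff.2 (sub_ne_zero.2 fun h => ?_)) _).ne'
  have hjk := unitPoint_injOn (hmem j) (hmem k) h
  exact (mem_Ioi.1 hk).ne (Fin.ext (by simpa using hjk))

theorem integral_ofReal_weight (N : ℕ) (κ : ℝ) :
    ∫ θ, (weight N κ θ : ℂ) ∂(boxMeasure N)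
      = ((∫ θ, weight N κ θ ∂(boxMeasure N) : ℝ) : ℂ) :=
  integral_ofReal

theorem integral_weight_ne_zero (hκ : 0 ≤ κ) :
    ∫ θ, (weight N κ θ : ℂ) ∂(boxMeasure N) ≠ 0 := by
  rw [integral_ofReal_weight, Complex.ofReal_ne_zero]
  intro h
  obtain ⟨θ, hθ, hne⟩ := exists_weight_ne_zero N κ
  have hint : Integrable (weight N κ) (boxMeasure N) := by
    simpa using (integrable_mul_weight hκ measurable_const (C := 1)
      (f := fun _ : Fin N → ℝ => 1) (by simp)).re
  have hae := (integral_eq_zero_iff_of_nonneg weight_nonneg hint).1 h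
  rw [boxMeasure, ← Measure.restrict_pi_pi] at hae
  exact hne (Measure.eqOn_open_of_ae_eq hae (isOpen_set_pi Set.finite_univ fun _ _ => isOpen_Ioo)
    (continuous_weight hκ).continuousOn continuousOn_const hθ)

theorem average_eq (N : ℕ) (κ : ℝ) (f : (Fin N → ℝ) → ℂ) :
    average N κ f = (∫ θ, f θ * (weight N κ θ : ℂ) ∂(boxMeasure N))
      / ∫ θ, (weight N κ θ : ℂ) ∂(boxMeasure N) := by
  have hπ : (2 * (π : ℂ)) ^ N ≠ 0 := by simp [Real.pi_ne_zero]
  simp only [average, density, partitionFunction, angleMeasure_eq, Complex.ofReal_mul,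
    mul_left_comm (f _)]
  rw [integral_const_mul, integral_ofReal_weight]
  push_cast
  field_simp

theorem average_const (hκ : 0 ≤ κ) (c : ℂ) : average N κ (fun _ => c) = c := by
  rw [average_eq, integral_const_mul, mul_div_cancel_right₀ _ (integral_weight_ne_zero hκ)]

theorem average_const_mul (c : ℂ) (f : (Fin N → ℝ) → ℂ) :
    average N κ (fun θ => c * f θ) = c * average N κ f := by
  simp only [average_eq, mul_assoc, integral_const_mul, mul_div_assoc]

theorem average_sum (hκ : 0 ≤ κ) {ι : Type*} {s : Finset ι} {F : ι → (Fin N → ℝ) → ℂ}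
    (hF : ∀ i, Measurable (F i)) {B : ℝ} (hB : ∀ i θ, ‖F i θ‖ ≤ B) :
    average N κ (fun θ => ∑ i ∈ s, F i θ) = ∑ i ∈ s, average N κ (F i) := by
  simp only [average_eq, sum_mul]
  rw [integral_finsetSum _ fun i _ => integrable_mul_weight hκ (hF i) (hB i), sum_div]

theorem hasSum_mul_average {ι : Type*} [Countable ι] (hκ : 0 ≤ κ) {c : ι → ℂ}
    {F : ι → (Fin N → ℝ) → ℂ} {f : (Fin N → ℝ) → ℂ} {B : ℝ} (hc : Summable fun i => ‖c i‖)
    (hF : ∀ i, Measurable (F i)) (hB : ∀ i θ, ‖F i θ‖ ≤ B)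
    (hf : ∀ θ, HasSum (fun i => c i * F i θ) (f θ)) :
    HasSum (fun i => c i * average N κ (F i)) (average N κ f) := by
  have hint (i : ι) := integrable_mul_weight hκ (hF i) (hB i)
  obtain ⟨K, hK⟩ : ∃ K, ∀ i, ∫ θ, ‖F i θ * (weight N κ θ : ℂ)‖ ∂(boxMeasure N) ≤ K := by
    refine ⟨∫ θ, B * weight N κ θ ∂(boxMeasure N), fun i => integral_mono (hint i).norm ?_ ?_⟩
    · simpa using (integrable_mul_weight hκ (measurable_const (a := (B : ℂ))) fun _ => le_rfl).re
    · intro θ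
      dsimp only
      rw [norm_mul, Complex.norm_real, Real.norm_of_nonneg (weight_nonneg θ)]
      exact mul_le_mul_of_nonneg_right (hB i θ) (weight_nonneg θ)
  have h := hasSum_integral_of_summable_integral_norm (μ := boxMeasure N)
    (F := fun i θ => c i * (F i θ * (weight N κ θ : ℂ))) (fun i => (hint i).const_mul _) ?_
  · simp only [average_eq, ← mul_div_assoc, ← integral_const_mul]
    refine HasSum.div_const ?_ _
    have hsum (θ : Fin N → ℝ) :
        ∑' i, c i * (F i θ * (weight N κ θ : ℂ)) = f θ * (weight N κ θ : ℂ) := by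
      simpa only [mul_assoc] using ((hf θ).mul_right (weight N κ θ : ℂ)).tsum_eq
    simpa only [hsum] using h
  · simp only [norm_mul (c _), integral_const_mul]
    exact (hc.mul_right K).of_nonneg_of_le
      (fun i => mul_nonneg (norm_nonneg _) (integral_nonneg fun _ => norm_nonneg _))
      fun i => mul_le_mul_of_nonneg_left (hK i) (norm_nonneg _)

end Average

theorem halfExp_pow (m : ℤ) (n : ℕ) (x : ℝ) : halfExp m x ^ n = halfExp (n * m) x := by
  unfold halfExp
  rw [← Complex.exp_nat_mul]
  congr 1
  push_cast
  ring

theorem unitPoint_sub_mul_halfExp (x y : ℝ) :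
    -I * ((unitPoint y - unitPoint x) * (halfExp (-1) x * halfExp (-1) y))
      = ((2 * Real.sin ((y - x) / 2) : ℝ) : ℂ) := by
  have hxy : I * y + (I * (-1 : ℤ) / 2 * x + I * (-1 : ℤ) / 2 * y) = (y - x) / 2 * I := by
    push_cast; ring
  have hyx : I * x + (I * (-1 : ℤ) / 2 * x + I * (-1 : ℤ) / 2 * y) = -((y - x) / 2) * I := by
    push_cast; ring
  rw [unitPoint, unitPoint, halfExp, halfExp, sub_mul, ← Complex.exp_add, ← Complex.exp_add,
    ← Complex.exp_add, hxy, hyx]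
  push_cast
  rw [Complex.sin]
  ring

theorem abs_sin_half_sub {x y : ℝ} (hx : x ∈ Set.Ioo 0 (2 * π)) (hy : y ∈ Set.Ioo 0 (2 * π)) :
    ((|2 * Real.sin ((y - x) / 2)| : ℝ) : ℂ)
      = csign (y - x) * ((2 * Real.sin ((y - x) / 2) : ℝ) : ℂ) := by
  obtain ⟨hx0, hx1⟩ := hx
  obtain ⟨hy0, hy1⟩ := hy
  rcases lt_trichotomy x y with hxy | rfl | hyx
  · have hsin := Real.sin_nonneg_of_nonneg_of_le_pi (x := (y - x) / 2) (by linarith) (by linarith)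
    rw [csign_of_pos (by linarith), one_mul, abs_of_nonneg (by linarith)]
  · simp
  · have hsin := Real.sin_nonpos_of_nonpos_of_neg_pi_le (x := (y - x) / 2) (by linarith)
      (by linarith)
    rw [csign_of_neg (by linarith), abs_of_nonpos (by linarith), neg_one_mul, Complex.ofReal_neg]

theorem norm_unitPoint_sub {x y : ℝ} (hx : x ∈ Set.Ioo 0 (2 * π)) (hy : y ∈ Set.Ioo 0 (2 * π)) :
    (‖unitPoint x - unitPoint y‖ : ℂ)
      = -I * (csign (y - x) * ((unitPoint y - unitPoint x) * (halfExp (-1) x * halfExp (-1) y))) :=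
  calc (‖unitPoint x - unitPoint y‖ : ℂ)
      = (‖-I * ((unitPoint y - unitPoint x) * (halfExp (-1) x * halfExp (-1) y))‖ : ℝ) := by
        rw [norm_sub_rev]
        simp [norm_halfExp]
    _ = csign (y - x) * ((2 * Real.sin ((y - x) / 2) : ℝ) : ℂ) := by
        rw [unitPoint_sub_mul_halfExp, Complex.norm_real, Real.norm_eq_abs, abs_sin_half_sub hx hy]
    _ = _ := by rw [← unitPoint_sub_mul_halfExp, mul_left_comm]

section OrthogonalWeight

variable {N : ℕ}

theorem prod_halfExp_mul_det_vandermonde (θ : Fin N → ℝ) :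
    (∏ j, halfExp (1 - N) (θ j)) * (Matrix.vandermonde fun j => unitPoint (θ j)).det
      = ∑ σ : Equiv.Perm (Fin N), ((Equiv.Perm.sign σ : ℤ) : ℂ)
          * ∏ j, halfExp (baseExp N (σ j)) (θ j) := by
  rw [← Matrix.det_transpose, Matrix.det_apply', mul_sum]
  refine sum_congr rfl fun σ _ => ?_
  rw [mul_left_comm, ← prod_mul_distrib]
  congr 1
  refine prod_congr rfl fun j _ => ?_
  rw [Matrix.transpose_apply, Matrix.vandermonde_apply, unitPoint_pow, ← halfExp_add, baseExp]
  congr 1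
  ring

/-- The constant `(-i)^{N(N-1)/2}` by which `∏_{j<k} |ζ_j - ζ_k|` differs from a sign times the
centred Vandermonde determinant of the `ζ_j`. -/
noncomputable def phase (N : ℕ) : ℂ := ∏ j : Fin N, ∏ _k ∈ Ioi j, -I

theorem weight_half_eq {θ : Fin N → ℝ} (hθ : ∀ j, θ j ∈ Set.Ioo 0 (2 * π)) :
    (weight N (1 / 2) θ : ℂ) = phase N * ∑ σ : Equiv.Perm (Fin N),
      ((Equiv.Perm.sign σ : ℤ) : ℂ) * ((∏ j, halfExp (baseExp N (σ j)) (θ j)) * ordSign θ) := by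
  have hfactor : (weight N (1 / 2) θ : ℂ) = ∏ j, ∏ k ∈ Ioi j, (-I * (csign (θ k - θ j)
      * ((unitPoint (θ k) - unitPoint (θ j)) * (halfExp (-1) (θ j) * halfExp (-1) (θ k))))) := by
    simp only [weight, Complex.ofReal_prod, mul_one_div_cancel (two_ne_zero' ℝ), Real.rpow_one,
      norm_unitPoint_sub (hθ _) (hθ _)]
  have hhalf : ∏ j, ∏ k ∈ Ioi j, (halfExp (-1) (θ j) * halfExp (-1) (θ k))
      = ∏ j, halfExp (1 - N) (θ j) := by
    rw [prod_prod_Ioi_mul_eq_prod_prod_off_diag fun _ i => halfExp (-1) (θ i)]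
    refine prod_congr rfl fun j _ => ?_
    rw [prod_const, card_compl, card_singleton, Fintype.card_fin, halfExp_pow]
    congr 1
    have := j.isLt
    omega
  calc (weight N (1 / 2) θ : ℂ)
      = phase N * (ordSign θ * ((Matrix.vandermonde fun j => unitPoint (θ j)).det
          * ∏ j, halfExp (1 - N) (θ j))) := by
        rw [hfactor, Matrix.det_vandermonde, ← hhalf]
        simp only [prod_mul_distrib, phase, ordSign]
    _ = _ := by
        rw [mul_comm (Matrix.det _), prod_halfExp_mul_det_vandermonde, mul_comm (ordSign θ),
          sum_mul]
        simp only [mul_assoc]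

theorem sign_mul_signFourier_baseExp_perm (σ : Equiv.Perm (Fin N)) (q : Fin N → ℤ) :
    ((Equiv.Perm.sign σ : ℤ) : ℂ) * signFourier (fun j => q j + baseExp N (σ j))
      = signFourier (baseExp N + q ∘ σ.symm) := by
  have hperm : (fun j => q j + baseExp N (σ j)) = fun j => (baseExp N + q ∘ σ.symm) (σ j) := by
    funext j
    simp [add_comm]
  have hsign : ((Equiv.Perm.sign σ : ℤ) : ℂ) * ((Equiv.Perm.sign σ : ℤ) : ℂ) = 1 := by
    rw [← Int.cast_mul, ← Units.val_mul, Int.units_mul_self, Units.val_one, Int.cast_one]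
  rw [hperm, signFourier_perm, ← mul_assoc, hsign, one_mul]

theorem integral_prod_halfExp_mul_weight (q : Fin N → ℤ) :
    ∫ θ, (∏ j, halfExp (q j) (θ j)) * (weight N (1 / 2) θ : ℂ) ∂(boxMeasure N)
      = phase N * ∑ σ : Equiv.Perm (Fin N), signFourier (baseExp N + q ∘ σ.symm) := by
  rw [sum_congr rfl fun σ _ => (sign_mul_signFourier_baseExp_perm σ q).symm]
  simp only [signFourier, ← integral_const_mul]
  rw [← integral_finsetSum _ fun σ _ => (integrable_prod_halfExp_mul_ordSign _).const_mul _,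
    ← integral_const_mul]
  refine integral_congr_ae ?_
  filter_upwards [ae_boxMeasure N] with θ hθ
  rw [weight_half_eq hθ, mul_left_comm, mul_sum]
  congr 1
  refine sum_congr rfl fun σ _ => ?_
  simp only [halfExp_add, prod_mul_distrib]
  ring

theorem integral_weight_half (N : ℕ) : ∫ θ, (weight N (1 / 2) θ : ℂ) ∂(boxMeasure N)
    = phase N * (N.factorial * signFourier (baseExp N)) := by
  have h := integral_prod_halfExp_mul_weight (N := N) 0
  simpa [Fintype.card_perm] using h

theorem average_prod_halfExp (q : Fin N → ℤ) :
    average N (1 / 2) (fun θ => ∏ j, halfExp (q j) (θ j))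
      = (∑ σ : Equiv.Perm (Fin N), signFourier (baseExp N + q ∘ σ.symm))
        / (N.factorial * signFourier (baseExp N)) := by
  have hphase : phase N ≠ 0 :=
    left_ne_zero_of_mul (integral_weight_half N ▸ integral_weight_ne_zero (by norm_num))
  rw [average_eq, integral_prod_halfExp_mul_weight, integral_weight_half,
    mul_div_mul_left _ _ hphase]

theorem signFourier_baseExp_ne_zero (N : ℕ) : signFourier (baseExp N) ≠ 0 :=
  right_ne_zero_of_mul (right_ne_zero_of_mul
    (integral_weight_half N ▸ integral_weight_ne_zero (by norm_num)))

end OrthogonalWeight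

/-- The power sum `∑_j ζ_j^k` of the eigenvalues `ζ_j = e^{iθ_j}`, for any integer `k`. -/
noncomputable def powerSum {N : ℕ} (k : ℤ) (θ : Fin N → ℝ) : ℂ := ∑ j, halfExp (2 * k) (θ j)

section PowerSum

variable {N : ℕ}

theorem norm_powerSum_le (k : ℤ) (θ : Fin N → ℝ) : ‖powerSum k θ‖ ≤ N :=
  (norm_sum_le _ _).trans (by simp [norm_halfExp])

theorem measurable_powerSum (k : ℤ) : Measurable (powerSum k : (Fin N → ℝ) → ℂ) :=
  measurable_sum _ fun j _ => (continuous_halfExp _).measurable.comp (measurable_pi_apply j)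

@[simp] theorem powerSum_zero (θ : Fin N → ℝ) : powerSum 0 θ = N := by
  simp [powerSum]

theorem prod_halfExp_single (m : ℤ) (a : Fin N) (θ : Fin N → ℝ) :
    ∏ j, halfExp ((Pi.single a m : Fin N → ℤ) j) (θ j) = halfExp m (θ a) := by
  rw [prod_eq_single a] <;> simp +contextual

theorem powerSum_mul_powerSum_neg (k l : ℤ) (θ : Fin N → ℝ) :
    powerSum k θ * powerSum (-l) θ = ∑ ab : Fin N × Fin N, ∏ j,
      halfExp ((Pi.single ab.1 (2 * k) - Pi.single ab.2 (2 * l) : Fin N → ℤ) j) (θ j) := by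
  rw [Fintype.sum_prod_type, powerSum, powerSum, sum_mul_sum]
  simp only [sub_eq_add_neg, Pi.add_apply, ← Pi.single_neg, halfExp_add, prod_mul_distrib,
    prod_halfExp_single, mul_neg]

theorem baseExp_add_single_sub_single_comp (k l : ℤ) (a b : Fin N) (σ : Equiv.Perm (Fin N)) :
    baseExp N + (Pi.single a (2 * k) - Pi.single b (2 * l) : Fin N → ℤ) ∘ σ.symm
      = shiftExp N k l (σ a) (σ b) := by
  funext j
  simp [shiftExp, Pi.single_apply, Equiv.symm_apply_eq, add_sub_assoc]

theorem average_powerSum_mul (k l : ℤ) :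
    average N (1 / 2) (fun θ => powerSum k θ * powerSum (-l) θ)
      = (∑ a, ∑ b, signFourier (shiftExp N k l a b)) / signFourier (baseExp N) := by
  have hperm (σ : Equiv.Perm (Fin N)) :
      ∑ ab : Fin N × Fin N, signFourier (shiftExp N k l (σ ab.1) (σ ab.2))
        = ∑ a, ∑ b, signFourier (shiftExp N k l a b) := by
    rw [← Fintype.sum_prod_type']
    exact Equiv.sum_comp (σ.prodCongr σ) fun ab => signFourier (shiftExp N k l ab.1 ab.2)
  have hfac : (N.factorial : ℂ) ≠ 0 := Nat.cast_ne_zero.2 N.factorial_ne_zero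
  simp only [powerSum_mul_powerSum_neg]
  rw [average_sum (by norm_num) (fun _ => measurable_prod_halfExp _)
    fun _ θ => (norm_prod_halfExp _ θ).le]
  simp only [average_prod_halfExp, baseExp_add_single_sub_single_comp]
  rw [← sum_div, sum_comm, sum_congr rfl fun σ _ => hperm σ, sum_const, card_univ,
    Fintype.card_perm, Fintype.card_fin, nsmul_eq_mul, mul_div_mul_left _ _ hfac]

theorem average_powerSum_mul_of_ne {k l : ℤ} (hkl : k ≠ l) :
    average N (1 / 2) (fun θ => powerSum k θ * powerSum (-l) θ) = 0 := by
  simp only [average_powerSum_mul, signFourier_shiftExp_of_ne hkl, sum_const_zero, zero_div]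

theorem average_powerSum {k : ℤ} (hk : k ≠ 0) : average N (1 / 2) (powerSum k) = 0 := by
  rcases eq_or_ne N 0 with rfl | hN
  · have hempty : (powerSum k : (Fin 0 → ℝ) → ℂ) = fun _ => 0 := by
      funext θ
      simp [powerSum]
    rw [hempty, average_const (by norm_num)]
  · have h := average_powerSum_mul_of_ne (N := N) hk
    simp only [neg_zero, powerSum_zero, mul_comm _ (N : ℂ), average_const_mul] at h
    exact (mul_eq_zero.1 h).resolve_left (Nat.cast_ne_zero.2 hN)

theorem average_powerSum_mul_self {k : ℕ} (hk : 1 ≤ k) :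
    average N (1 / 2) (fun θ => powerSum k θ * powerSum (-k) θ)
      = ∑ a : Fin N, if N ≤ a + k then 1 + (baseExp N a : ℂ) / (baseExp N a + 2 * k) else 0 := by
  simp only [average_powerSum_mul, sum_signFourier_shiftExp hk]
  rw [← mul_sum, mul_div_cancel_left₀ _ (signFourier_baseExp_ne_zero N)]

end PowerSum

/-- The Taylor coefficients in `t` of the Herglotz kernel `(1 + xt) / (1 - xt)`. -/
noncomputable def herglotzCoeff (x : ℂ) (k : ℕ) : ℂ := if k = 0 then 1 else 2 * x ^ k

@[simp] theorem herglotzCoeff_zero (x : ℂ) : herglotzCoeff x 0 = 1 := if_pos rfl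

theorem herglotzCoeff_of_ne_zero (x : ℂ) {k : ℕ} (hk : k ≠ 0) : herglotzCoeff x k = 2 * x ^ k :=
  if_neg hk

theorem herglotzCoeff_mul (x y : ℂ) (k : ℕ) :
    herglotzCoeff (x * y) k = herglotzCoeff x k * y ^ k := by
  rcases eq_or_ne k 0 with rfl | hk
  · simp
  · rw [herglotzCoeff_of_ne_zero _ hk, herglotzCoeff_of_ne_zero _ hk, mul_pow, mul_assoc]

theorem summable_norm_herglotzCoeff {x : ℂ} (hx : ‖x‖ < 1) :
    Summable fun k => ‖herglotzCoeff x k‖ := by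
  refine ((summable_geometric_of_lt_one (norm_nonneg _) hx).mul_left 2).of_nonneg_of_le
    (fun _ => norm_nonneg _) fun k => ?_
  rcases eq_or_ne k 0 with rfl | hk
  · simp
  · simp [herglotzCoeff_of_ne_zero _ hk]

theorem hasSum_herglotzCoeff_div {z w : ℂ} (h : ‖z‖ < ‖w‖) :
    HasSum (herglotzCoeff (z / w)) ((w + z) / (w - z)) := by
  have hw : w ≠ 0 := norm_pos_iff.1 ((norm_nonneg z).trans_lt h)
  have hwz : w - z ≠ 0 := sub_ne_zero.2 fun hwz => h.ne (by rw [hwz])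
  have hlt : ‖z / w‖ < 1 := by rwa [norm_div, div_lt_one (norm_pos_iff.2 hw)]
  have hval : (w + z) / (w - z) = 2 * (1 - z / w)⁻¹ - 1 := by
    rw [one_sub_div hw, inv_div]
    field_simp
    ring
  rw [hval]
  refine (((hasSum_geometric_of_norm_lt_one hlt).mul_left 2).sub (hasSum_ite_eq 0 1)).congr_fun
    fun k => ?_
  rcases eq_or_ne k 0 with rfl | hk
  · norm_num
  · simp [herglotzCoeff_of_ne_zero _ hk, hk]

section Resolvent

variable {N : ℕ}

theorem hasSum_herglotzSum_of_lt {z : ℂ} (hz : ‖z‖ < 1) (θ : Fin N → ℝ) :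
    HasSum (fun k : ℕ => herglotzCoeff z k * powerSum (-k) θ) (herglotzSum N z θ) := by
  simp only [herglotzSum, powerSum, mul_sum]
  refine hasSum_sum fun j _ => ?_
  refine (hasSum_herglotzCoeff_div (by rwa [norm_unitPoint])).congr_fun fun k => ?_
  rw [div_eq_mul_inv, herglotzCoeff_mul, unitPoint_inv, halfExp_pow]
  congr 2
  ring

theorem hasSum_herglotzSum_of_gt {z : ℂ} (hz : 1 < ‖z‖) (θ : Fin N → ℝ) :
    HasSum (fun k : ℕ => -herglotzCoeff z⁻¹ k * powerSum k θ) (herglotzSum N z θ) := by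
  simp only [herglotzSum, powerSum, mul_sum]
  refine hasSum_sum fun j _ => ?_
  rw [← neg_sub z, div_neg, add_comm]
  refine (hasSum_herglotzCoeff_div (by rwa [norm_unitPoint])).neg.congr_fun fun k => ?_
  rw [div_eq_inv_mul, herglotzCoeff_mul, unitPoint_pow, neg_mul]

theorem average_of_hasSum_powerSum {c : ℕ → ℂ} {e : ℕ → ℤ} {f : (Fin N → ℝ) → ℂ}
    (hc : Summable fun k => ‖c k‖) (he : ∀ k, e k = 0 ↔ k = 0)
    (hf : ∀ θ, HasSum (fun k => c k * powerSum (e k) θ) (f θ)) :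
    average N (1 / 2) f = c 0 * N := by
  have hsum := hasSum_mul_average one_half_pos.le hc (fun _ => measurable_powerSum _)
    (fun _ => norm_powerSum_le _) hf
  have hconst : (powerSum 0 : (Fin N → ℝ) → ℂ) = fun _ => (N : ℂ) := funext powerSum_zero
  refine hsum.unique ?_
  convert hasSum_single 0 fun k hk => ?_ using 1
  · rw [(he 0).2 rfl, hconst, average_const one_half_pos.le]
  · rw [average_powerSum (mt (he k).1 hk), mul_zero]

theorem norm_inv_lt_one {z : ℂ} (hz : 1 < ‖z‖) : ‖z⁻¹‖ < 1 := by
  rw [norm_inv]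
  exact inv_lt_one_of_one_lt₀ hz

theorem W₁_of_lt {z : ℂ} (hz : ‖z‖ < 1) : W₁ N (1 / 2) z = N := by
  rw [W₁, average_of_hasSum_powerSum (summable_norm_herglotzCoeff hz) (fun k => by simp)
    (hasSum_herglotzSum_of_lt hz), herglotzCoeff_zero, one_mul]

theorem W₁_of_gt {z : ℂ} (hz : 1 < ‖z‖) : W₁ N (1 / 2) z = -N := by
  have hc : Summable fun k => ‖-herglotzCoeff z⁻¹ k‖ := by
    simpa only [norm_neg] using summable_norm_herglotzCoeff (norm_inv_lt_one hz)
  rw [W₁, average_of_hasSum_powerSum hc (fun k => Nat.cast_eq_zero)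
    (hasSum_herglotzSum_of_gt hz), herglotzCoeff_zero, neg_one_mul]

theorem norm_powerSum_mul_powerSum_le (k l : ℤ) (θ : Fin N → ℝ) :
    ‖powerSum k θ * powerSum l θ‖ ≤ N * N := by
  rw [norm_mul]
  gcongr <;> exact norm_powerSum_le _ _

theorem summable_norm_herglotzCoeff_mul {z₁ z₂ : ℂ} (hz₁ : ‖z₁‖ < 1) (hz₂ : 1 < ‖z₂‖) :
    Summable fun kl : ℕ × ℕ => ‖-herglotzCoeff z₂⁻¹ kl.1 * herglotzCoeff z₁ kl.2‖ := by
  simpa only [neg_mul, norm_neg] using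
    (summable_norm_herglotzCoeff (norm_inv_lt_one hz₂)).mul_norm (summable_norm_herglotzCoeff hz₁)

theorem hasSum_herglotzSum_mul {z₁ z₂ : ℂ} (hz₁ : ‖z₁‖ < 1) (hz₂ : 1 < ‖z₂‖) (θ : Fin N → ℝ) :
    HasSum (fun kl : ℕ × ℕ => -herglotzCoeff z₂⁻¹ kl.1 * herglotzCoeff z₁ kl.2
        * (powerSum kl.1 θ * powerSum (-kl.2) θ))
      (herglotzSum N z₁ θ * herglotzSum N z₂ θ) := by
  have hsummable : Summable fun kl : ℕ × ℕ => (-herglotzCoeff z₂⁻¹ kl.1 * powerSum (kl.1 : ℤ) θ)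
      * (herglotzCoeff z₁ kl.2 * powerSum (-(kl.2 : ℤ)) θ) := by
    refine .of_norm_bounded ((summable_norm_herglotzCoeff_mul hz₁ hz₂).mul_right (N * N : ℝ))
      fun kl => ?_
    rw [mul_mul_mul_comm, norm_mul]
    exact mul_le_mul_of_nonneg_left (norm_powerSum_mul_powerSum_le _ _ θ) (norm_nonneg _)
  rw [mul_comm (herglotzSum N z₁ θ)]
  simpa only [mul_mul_mul_comm] using
    (hasSum_herglotzSum_of_gt hz₂ θ).mul (hasSum_herglotzSum_of_lt hz₁ θ) hsummable

theorem hasSum_U₂ {z₁ z₂ : ℂ} (hz₁ : ‖z₁‖ < 1) (hz₂ : 1 < ‖z₂‖) :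
    HasSum (fun k : ℕ => -(herglotzCoeff z₁ k * herglotzCoeff z₂⁻¹ k)
      * average N (1 / 2) fun θ => powerSum k θ * powerSum (-k) θ) (U₂ N (1 / 2) z₁ z₂) := by
  have hdouble := hasSum_mul_average (N := N) one_half_pos.le
    (summable_norm_herglotzCoeff_mul hz₁ hz₂)
    (F := fun (kl : ℕ × ℕ) θ => powerSum kl.1 θ * powerSum (-kl.2) θ)
    (fun _ => (measurable_powerSum _).mul (measurable_powerSum _))
    (fun _ => norm_powerSum_mul_powerSum_le _ _) (hasSum_herglotzSum_mul hz₁ hz₂)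
  have hdiag : Function.Injective fun k : ℕ => (k, k) := fun a b hab => congrArg Prod.fst hab
  refine ((hdiag.hasSum_iff ?_).2 hdouble).congr_fun fun k => ?_
  · rintro ⟨k, l⟩ hkl
    have hne : (k : ℤ) ≠ l := fun h => hkl ⟨k, by simpa using h⟩
    simp only [average_powerSum_mul_of_ne hne, mul_zero]
  · simp only [Function.comp_apply, neg_mul, mul_comm (herglotzCoeff z₁ k)]

theorem hasSum_coeW₂ {z₁ z₂ : ℂ} (hz₁ : ‖z₁‖ < 1) (hz₂ : 1 < ‖z₂‖) :
    HasSum (fun k : ℕ => -4 * (z₁ / z₂) ^ (k + 1)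
      * average N (1 / 2) fun θ => powerSum ((k + 1 : ℕ) : ℤ) θ * powerSum (-((k + 1 : ℕ) : ℤ)) θ)
      (coeW₂ N z₁ z₂) := by
  have hW : coeW₂ N z₁ z₂ = U₂ N (1 / 2) z₁ z₂ + N * N := by
    rw [coeW₂, W₂, W₁_of_lt hz₁, W₁_of_gt hz₂]
    ring
  rw [hW]
  have htail := (hasSum_nat_add_iff' 1).2 (hasSum_U₂ (N := N) hz₁ hz₂)
  simp only [sum_range_one, Nat.cast_zero, neg_zero, powerSum_zero, herglotzCoeff_zero,
    average_const one_half_pos.le, neg_mul, one_mul, sub_neg_eq_add] at htail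
  refine htail.congr_fun fun k => ?_
  rw [herglotzCoeff_of_ne_zero _ k.add_one_ne_zero, herglotzCoeff_of_ne_zero _ k.add_one_ne_zero,
    div_eq_mul_inv, mul_pow]
  ring

end Resolvent

/-- The Lerch transcendent `Φ(ζ, 1, b) = ∑_n ζ^n / (b + n)`. -/
noncomputable def lerchPhi (b ζ : ℂ) : ℂ := ∑' n : ℕ, ζ ^ n / (b + n)

theorem hasSum_lerchPhi {b ζ : ℂ} (hb : 0 < b.re) (hζ : ‖ζ‖ < 1) :
    HasSum (fun n : ℕ => ζ ^ n / (b + n)) (lerchPhi b ζ) := by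
  refine Summable.hasSum (.of_norm_bounded
    ((summable_geometric_of_lt_one (norm_nonneg ζ) hζ).div_const b.re) fun n => ?_)
  rw [norm_div, norm_pow]
  refine div_le_div_of_nonneg_left (by positivity) hb ?_
  calc b.re ≤ (b + n).re := by simp
    _ ≤ ‖b + n‖ := Complex.re_le_norm _

theorem ordinaryHypergeometric_one_add_one {b : ℂ} (hb : ∀ n : ℕ, b + n ≠ 0) (ζ : ℂ) :
    ordinaryHypergeometric 1 b (b + 1) ζ = b * lerchPhi b ζ := by
  rw [ordinaryHypergeometric_eq_tsum, lerchPhi, ← tsum_mul_left]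
  refine tsum_congr fun n => ?_
  have hpoch : b * (ascPochhammer ℂ n).eval (b + 1) = (ascPochhammer ℂ n).eval b * (b + n) := by
    rw [← ascPochhammer_succ_eval, ascPochhammer_succ_left]
    simp
  have hpoch_ne : (ascPochhammer ℂ n).eval (b + 1) ≠ 0 := by
    rw [Ne, ascPochhammer_eval_eq_zero_iff]
    rintro ⟨k, -, hk⟩
    refine hb (k + 1) ?_
    push_cast
    linear_combination hk
  rw [ascPochhammer_eval_one, inv_mul_cancel₀ (Nat.cast_ne_zero.2 n.factorial_ne_zero), one_mul,
    smul_eq_mul, mul_right_comm, ← div_eq_mul_inv, mul_div_assoc', div_eq_div_iff hpoch_ne (hb n)]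
  linear_combination -ζ ^ n * hpoch

theorem one_sub_ne_zero_of_norm_lt_one {ζ : ℂ} (hζ : ‖ζ‖ < 1) : 1 - ζ ≠ 0 :=
  sub_ne_zero.2 fun h => by simp [← h] at hζ

theorem hasSum_ite_le {f : ℕ → ℂ} {s : ℂ} (hf : HasSum f s) (i : ℕ) :
    HasSum (fun n => if i ≤ n then f (n - i) else 0) s := by
  rw [← (add_left_injective i).hasSum_iff]
  · simpa [Function.comp_def] using hf
  · exact fun n hn => if_neg fun hin => hn ⟨n - i, Nat.sub_add_cancel hin⟩

theorem sum_range_pow_succ_mul {ζ : ℂ} (hζ : 1 - ζ ≠ 0) (N : ℕ) (A B c : ℂ) :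
    ∑ i ∈ range N, ζ ^ (i + 1) * (A + (c - i) * B)
      = (A + c * B) * (ζ * (1 - ζ ^ N) / (1 - ζ))
        - B * (ζ * (ζ - N * ζ ^ N + (N - 1) * ζ ^ (N + 1)) / (1 - ζ) ^ 2) := by
  induction N with
  | zero => simp
  | succ N ih =>
    rw [sum_range_succ, ih]
    field_simp
    push_cast
    ring

section ClosedForm

variable {N : ℕ}

theorem half_add_one_re_pos (N : ℕ) : 0 < (((N : ℂ) + 1) / 2).re := by
  rw [← Nat.cast_add_one, Complex.div_ofNat_re, Complex.natCast_re]
  positivity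

theorem half_add_one_add_ne_zero (N n : ℕ) : ((N : ℂ) + 1) / 2 + n ≠ 0 := by
  have hne : ((N + 1 + 2 * n : ℕ) : ℂ) ≠ 0 := Nat.cast_ne_zero.2 (by omega)
  push_cast at hne
  exact fun h => hne (by linear_combination 2 * h)

theorem hasSum_ite_baseExp {ζ : ℂ} (hζ : ‖ζ‖ < 1) (a : Fin N) :
    HasSum (fun k : ℕ => -4 * ζ ^ (k + 1) * if N ≤ a + (k + 1) then
        1 + (baseExp N a : ℂ) / (baseExp N a + 2 * (k + 1 : ℕ)) else 0)
      (-4 * (ζ ^ ((a.rev : ℕ) + 1)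
        * ((1 - ζ)⁻¹ + (((N : ℂ) - 1) / 2 - (a.rev : ℕ)) * lerchPhi (((N : ℂ) + 1) / 2) ζ))) := by
  set i : ℕ := (a.rev : ℕ) with hi
  have hrev : (a : ℕ) + i + 1 = N := by rw [hi, Fin.val_rev]; omega
  have hbase : (baseExp N a : ℂ) = N - 1 - 2 * i := by
    have hbase_int : baseExp N a = N - 1 - 2 * i := by
      unfold baseExp
      omega
    simp [hbase_int]
  have hsum := (((hasSum_geometric_of_norm_lt_one hζ).add ((hasSum_lerchPhi (half_add_one_re_pos N)
    hζ).mul_left (((N : ℂ) - 1) / 2 - i))).mul_left (ζ ^ (i + 1))).mul_left (-4)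
  refine (hasSum_ite_le hsum i).congr_fun fun k => ?_
  by_cases hik : i ≤ k
  · obtain ⟨n, rfl⟩ := Nat.exists_eq_add_of_le hik
    have hden : (baseExp N a : ℂ) + 2 * (i + n + 1 : ℕ) = 2 * (((N : ℂ) + 1) / 2 + n) := by
      rw [hbase]; push_cast; ring
    rw [if_pos (by omega), if_pos hik, hden, hbase, Nat.add_sub_cancel_left]
    field_simp
    ring
  · rw [if_neg (by omega), if_neg hik, mul_zero]

theorem norm_div_lt_one {z₁ z₂ : ℂ} (hz₁ : ‖z₁‖ < 1) (hz₂ : 1 < ‖z₂‖) : ‖z₁ / z₂‖ < 1 := by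
  rw [norm_div, div_lt_one (one_pos.trans hz₂)]
  exact hz₁.trans hz₂

theorem coeW₂_eq_sum {z₁ z₂ : ℂ} (hz₁ : ‖z₁‖ < 1) (hz₂ : 1 < ‖z₂‖) :
    coeW₂ N z₁ z₂ = ∑ i ∈ range N, -4 * ((z₁ / z₂) ^ (i + 1)
      * ((1 - z₁ / z₂)⁻¹ + (((N : ℂ) - 1) / 2 - i) * lerchPhi (((N : ℂ) + 1) / 2) (z₁ / z₂))) := by
  have hsum := hasSum_sum fun a (_ : a ∈ univ) =>
    hasSum_ite_baseExp (N := N) (norm_div_lt_one hz₁ hz₂) a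
  rw [sum_range, ← Equiv.sum_comp Fin.revPerm]
  refine (hasSum_coeW₂ hz₁ hz₂).unique (hsum.congr_fun fun k => ?_)
  rw [average_powerSum_mul_self (Nat.le_add_left 1 k), mul_sum]

theorem coeW₂_eq_lerchPhi {z₁ z₂ ζ : ℂ} (hz₁ : ‖z₁‖ < 1) (hz₂ : 1 < ‖z₂‖) (hζ : ζ = z₁ / z₂) :
    coeW₂ N z₁ z₂ = -4 * ζ * (1 - ζ ^ N) / (1 - ζ) ^ 2
      + 2 * (2 * ζ ^ 2 * (1 - ζ ^ N) / (1 - ζ) ^ 2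
        - ζ * ((N : ℂ) - 1 + (N + 1) * ζ ^ N) / (1 - ζ)) * lerchPhi (((N : ℂ) + 1) / 2) ζ := by
  have hne : 1 - ζ ≠ 0 := hζ ▸ one_sub_ne_zero_of_norm_lt_one (norm_div_lt_one hz₁ hz₂)
  rw [coeW₂_eq_sum hz₁ hz₂, ← hζ, ← mul_sum, sum_range_pow_succ_mul hne]
  field_simp
  ring

theorem coeW₂_eq_coeExact {z₁ z₂ : ℂ} (hz₁ : ‖z₁‖ < 1) (hz₂ : 1 < ‖z₂‖) :
    coeW₂ N z₁ z₂ = coeExact N (z₁ / z₂) := by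
  have hne := one_sub_ne_zero_of_norm_lt_one (norm_div_lt_one hz₁ hz₂)
  have hN : (N : ℂ) + 1 ≠ 0 := Nat.cast_add_one_ne_zero N
  have hb : ((N : ℂ) + 3) / 2 = ((N : ℂ) + 1) / 2 + 1 := by ring
  rw [coeW₂_eq_lerchPhi hz₁ hz₂ rfl, coeExact, hb,
    ordinaryHypergeometric_one_add_one (half_add_one_add_ne_zero N)]
  generalize z₁ / z₂ = ζ at hne ⊢
  field_simp
  ring

end ClosedForm

/-- The Eulerian numbers of type `B`: the coefficients of the polynomials `E_j` with
`∑_n (2n+1)^j ζ^n = E_j(ζ) / (1-ζ)^(j+1)`. -/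
def eulerianB : ℕ → ℕ → ℕ
  | 0, 0 => 1
  | 0, _ + 1 => 0
  | j + 1, 0 => eulerianB j 0
  | j + 1, k + 1 => (2 * k + 3) * eulerianB j (k + 1) + (2 * (j - k) + 1) * eulerianB j k

theorem eulerianB_eq_zero_of_lt {j k : ℕ} (hjk : j < k) : eulerianB j k = 0 := by
  induction j generalizing k with
  | zero =>
    obtain ⟨k, rfl⟩ := Nat.exists_eq_add_of_lt hjk
    simp [eulerianB]
  | succ j ih =>
    obtain ⟨k, rfl⟩ := Nat.exists_eq_add_of_lt hjk
    rw [eulerianB, ih (by omega), ih (by omega), mul_zero, mul_zero, add_zero]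

theorem two_mul_add_one_mul_choose (n d k : ℕ) :
    (2 * n + 1) * (n + d).choose (k + d) =
      (2 * k + 1) * (n + d + 1).choose (k + d + 1) + (2 * d + 1) * (n + d).choose (k + d + 1) := by
  rcases lt_or_ge n k with hnk | hkn
  · rw [Nat.choose_eq_zero_of_lt (by omega), Nat.choose_eq_zero_of_lt (by omega),
      Nat.choose_eq_zero_of_lt (by omega), mul_zero, mul_zero, mul_zero, add_zero]
  · obtain ⟨m, rfl⟩ := Nat.exists_eq_add_of_le hkn
    have hratio := Nat.choose_succ_right_eq (k + m + d) (k + d)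
    rw [show k + m + d - (k + d) = m by omega] at hratio
    rw [Nat.choose_succ_succ]
    linear_combination 2 * hratio.symm

/-- Worpitzky's identity of type `B`. -/
theorem sum_eulerianB_mul_choose (j n : ℕ) :
    ∑ k ∈ range (j + 1), eulerianB j k * (n + j - k).choose j = (2 * n + 1) ^ j := by
  induction j with
  | zero => simp [eulerianB]
  | succ j ih =>
    have hsplit : ∀ k ∈ range (j + 1), (2 * n + 1) * (eulerianB j k * (n + j - k).choose j) =
        (2 * k + 1) * eulerianB j k * (n + (j + 1) - k).choose (j + 1) +
          (2 * (j - k) + 1) * eulerianB j k * (n + (j + 1) - (k + 1)).choose (j + 1) := by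
      intro k hk
      obtain ⟨d, rfl⟩ := Nat.exists_eq_add_of_le (mem_range_succ_iff.1 hk)
      have hchoose := two_mul_add_one_mul_choose n d k
      rw [show n + (k + d) - k = n + d by omega, show n + (k + d + 1) - k = n + d + 1 by omega,
        show n + (k + d + 1) - (k + 1) = n + d by omega, Nat.add_sub_cancel_left]
      linear_combination eulerianB (k + d) k * hchoose
    have hshift : ∑ k ∈ range (j + 1), (2 * k + 1) * eulerianB j k *
          (n + (j + 1) - k).choose (j + 1) =
        ∑ k ∈ range (j + 1), (2 * (k + 1) + 1) * eulerianB j (k + 1) *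
          (n + (j + 1) - (k + 1)).choose (j + 1) +
          eulerianB j 0 * (n + (j + 1)).choose (j + 1) := by
      have hzero := sum_range_succ' (fun k => (2 * k + 1) * eulerianB j k *
        (n + (j + 1) - k).choose (j + 1)) (j + 1)
      rw [sum_range_succ, eulerianB_eq_zero_of_lt j.lt_succ_self] at hzero
      simpa using hzero
    rw [sum_range_succ' _ (j + 1), pow_succ', ← ih, mul_sum, sum_congr rfl hsplit,
      sum_add_distrib, hshift, add_right_comm, ← sum_add_distrib]
    simp only [eulerianB, Nat.sub_zero]
    congr 1
    exact sum_congr rfl fun k _ => by ring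

/-- The generating polynomial `E_j` of the Eulerian numbers of type `B`. -/
def eulerianBPoly (j : ℕ) (ζ : ℂ) : ℂ := ∑ k ∈ range (j + 1), eulerianB j k * ζ ^ k

theorem hasSum_two_mul_add_one_pow_mul {ζ : ℂ} (hζ : ‖ζ‖ < 1) (j : ℕ) :
    HasSum (fun n : ℕ => (2 * n + 1 : ℂ) ^ j * ζ ^ n) (eulerianBPoly j ζ / (1 - ζ) ^ (j + 1)) := by
  have hsum := hasSum_sum fun k (_ : k ∈ range (j + 1)) =>
    (hasSum_ite_le (hasSum_choose_mul_geometric_of_norm_lt_one j hζ) k).mul_left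
      (eulerianB j k * ζ ^ k)
  rw [← sum_mul, mul_one_div] at hsum
  refine hsum.congr_fun fun n => ?_
  rw [← Nat.cast_ofNat, ← Nat.cast_mul, ← Nat.cast_add_one, ← Nat.cast_pow,
    ← sum_eulerianB_mul_choose, Nat.cast_sum, sum_mul]
  refine sum_congr rfl fun k hk => ?_
  split_ifs with hkn
  · obtain ⟨m, rfl⟩ := Nat.exists_eq_add_of_le hkn
    rw [show k + m + j - k = m + j by omega, Nat.add_sub_cancel_left]
    push_cast
    ring
  · rw [Nat.choose_eq_zero_of_lt (by have := mem_range_succ_iff.1 hk; omega)]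
    simp

/-- The large `N` expansion of `lerchPhi ((N + 1) / 2) ζ`, truncated after the term in `N⁻ᴶ`. -/
noncomputable def lerchExpansion (J N : ℕ) (ζ : ℂ) : ℂ :=
  -2 * ∑ j ∈ range J, eulerianBPoly j ζ / (N * (ζ - 1)) ^ (j + 1)

/-- The numerators `P_j` of the global large `N` expansion, with `P_0 = 1`. -/
noncomputable def expansionPoly : ℕ → ℂ → ℂ
  | 0, _ => 1
  | j + 1, ζ => (eulerianBPoly (j + 1) ζ + (1 + ζ) * eulerianBPoly j ζ) / 2

/-- The global large `N` expansion of `coeW₂`, truncated after the term in `N⁻ᴶ`. -/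
noncomputable def coeExpansion (J N : ℕ) (ζ : ℂ) : ℂ :=
  -8 * ∑ j ∈ range (J + 1), ζ * expansionPoly j ζ / (N ^ j * (ζ - 1) ^ (j + 2))

theorem coeExpansion_nine (N : ℕ) (ζ : ℂ) : coeExpansion 9 N ζ = coeGlobalExpansion N ζ := by
  simp only [coeExpansion, expansionPoly, eulerianBPoly, sum_range_succ, range_zero, sum_empty,
    eulerianB, coeGlobalExpansion]
  push_cast
  ring

section Expansion

variable {N : ℕ} {ζ : ℂ}

theorem inv_add_sub_sum_range {x y : ℂ} (hx : x ≠ 0) (hxy : x + y ≠ 0) (J : ℕ) :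
    (x + y)⁻¹ - ∑ j ∈ range J, (-y) ^ j / x ^ (j + 1) = (-y) ^ J / (x ^ J * (x + y)) := by
  induction J with
  | zero => simp
  | succ J ih =>
    rw [sum_range_succ, ← sub_sub, ih]
    field_simp
    ring

theorem hasSum_lerchPhi_sub_lerchExpansion (hN : 1 ≤ N) (hζ : ‖ζ‖ < 1) (J : ℕ) :
    HasSum (fun n : ℕ => 2 * ζ ^ n * ((-(2 * n + 1)) ^ J / (N ^ J * (N + (2 * n + 1)))))
      (lerchPhi (((N : ℂ) + 1) / 2) ζ - lerchExpansion J N ζ) := by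
  have hN' : (N : ℂ) ≠ 0 := Nat.cast_ne_zero.2 (by omega)
  have hne : ζ - 1 ≠ 0 := by
    rw [← neg_sub, neg_ne_zero]
    exact one_sub_ne_zero_of_norm_lt_one hζ
  have hexp := hasSum_sum fun j (_ : j ∈ range J) =>
    (hasSum_two_mul_add_one_pow_mul hζ j).mul_left (2 * (-1) ^ j / (N : ℂ) ^ (j + 1))
  have hval : ∑ j ∈ range J, 2 * (-1) ^ j / (N : ℂ) ^ (j + 1) *
      (eulerianBPoly j ζ / (1 - ζ) ^ (j + 1)) = lerchExpansion J N ζ := by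
    rw [lerchExpansion, mul_sum]
    refine sum_congr rfl fun j _ => ?_
    rw [← neg_sub ζ 1, neg_pow (ζ - 1), mul_pow, pow_succ (-1 : ℂ)]
    field_simp
  rw [hval] at hexp
  refine ((hasSum_lerchPhi (half_add_one_re_pos N) hζ).sub hexp).congr_fun fun n => ?_
  have hNn : (N : ℂ) + (2 * n + 1) ≠ 0 := by
    have := half_add_one_add_ne_zero N n
    exact fun h => this (by linear_combination h / 2)
  rw [← inv_add_sub_sum_range hN' hNn, mul_sub, mul_sum]
  congr 1
  · rw [show ((N : ℂ) + 1) / 2 + n = (N + (2 * n + 1)) / 2 by ring]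
    field_simp
  · refine sum_congr rfl fun j _ => ?_
    rw [neg_pow]
    ring

end Expansion

section UniformBounds

open Asymptotics

variable {ρ : ℝ}

/-- The filter on pairs `(N, ζ)` whose `O`-notation expresses bounds that are uniform in `N ≥ 1`
and `|ζ| ≤ ρ`. -/
def uniformFilter (ρ : ℝ) : Filter (ℕ × ℂ) := 𝓟 {x | 1 ≤ x.1 ∧ ‖x.2‖ ≤ ρ}

theorem isBigO_uniformFilter {f : ℕ × ℂ → ℂ} {k : ℕ} :
    (f =O[uniformFilter ρ] fun x => ((x.1 : ℝ) ^ k)⁻¹) ↔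
      ∃ C : ℝ, ∀ (N : ℕ) (ζ : ℂ), 1 ≤ N → ‖ζ‖ ≤ ρ → ‖f (N, ζ)‖ ≤ C / (N : ℝ) ^ k := by
  simp [uniformFilter, isBigO_principal, div_eq_mul_inv]

theorem isBigO_natCast_mul {f : ℕ × ℂ → ℂ} {k : ℕ}
    (hf : f =O[uniformFilter ρ] fun x => ((x.1 : ℝ) ^ (k + 1))⁻¹) :
    (fun x => (x.1 : ℂ) * f x) =O[uniformFilter ρ] fun x => ((x.1 : ℝ) ^ k)⁻¹ := by
  obtain ⟨C, hC⟩ := isBigO_uniformFilter.1 hf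
  refine isBigO_uniformFilter.2 ⟨C, fun N ζ hN hζ => ?_⟩
  have hN' : (N : ℝ) ≠ 0 := Nat.cast_ne_zero.2 (by omega)
  calc ‖(N : ℂ) * f (N, ζ)‖ ≤ N * (C / (N : ℝ) ^ (k + 1)) := by
        rw [norm_mul, Complex.norm_natCast]
        gcongr
        exact hC N ζ hN hζ
    _ = C / (N : ℝ) ^ k := by
        rw [pow_succ]
        field_simp

theorem isBigO_snd_pow_fst (hρ₀ : 0 ≤ ρ) (hρ : ρ < 1) (k : ℕ) :
    (fun x : ℕ × ℂ => x.2 ^ x.1) =O[uniformFilter ρ] fun x => ((x.1 : ℝ) ^ k)⁻¹ := by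
  obtain ⟨C, hC⟩ := (tendsto_pow_const_mul_const_pow_of_lt_one k hρ₀ hρ).bddAbove_range
  refine isBigO_uniformFilter.2 ⟨C, fun N ζ hN hζ => ?_⟩
  rw [le_div_iff₀ (by positivity), mul_comm, norm_pow]
  exact (by gcongr : _ ≤ (N : ℝ) ^ k * ρ ^ N).trans (hC ⟨N, rfl⟩)

theorem isBigO_inv_one_sub (hρ : ρ < 1) :
    (fun x : ℕ × ℂ => (1 - x.2)⁻¹) =O[uniformFilter ρ] (1 : ℕ × ℂ → ℝ) := by
  refine .of_bound (1 - ρ)⁻¹ (eventually_principal.2 fun x hx => ?_)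
  rw [norm_inv, Pi.one_apply, norm_one, mul_one]
  refine inv_anti₀ (sub_pos.2 hρ) ?_
  calc 1 - ρ ≤ ‖(1 : ℂ)‖ - ‖x.2‖ := by rw [norm_one]; linarith [hx.2]
    _ ≤ ‖1 - x.2‖ := norm_sub_norm_le _ _

theorem summable_two_mul_add_one_pow_mul (hρ₀ : 0 ≤ ρ) (hρ : ρ < 1) (J : ℕ) :
    Summable fun n : ℕ => (2 * n + 1 : ℝ) ^ J * ρ ^ n := by
  have hnorm : ‖(ρ : ℂ)‖ < 1 := by rwa [Complex.norm_of_nonneg hρ₀]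
  exact_mod_cast (hasSum_two_mul_add_one_pow_mul hnorm J).summable

theorem isBigO_lerchPhi_sub_lerchExpansion (hρ : ρ < 1) (J : ℕ) :
    (fun x : ℕ × ℂ => lerchPhi (((x.1 : ℂ) + 1) / 2) x.2 - lerchExpansion J x.1 x.2)
      =O[uniformFilter ρ] fun x => ((x.1 : ℝ) ^ (J + 1))⁻¹ := by
  refine isBigO_uniformFilter.2 ⟨∑' n : ℕ, 2 * ((2 * n + 1 : ℝ) ^ J * ρ ^ n), fun N ζ hN hζ => ?_⟩
  have hρ₀ : 0 ≤ ρ := (norm_nonneg ζ).trans hζ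
  have hsummable := (summable_two_mul_add_one_pow_mul hρ₀ hρ J).mul_left 2
  refine (hasSum_lerchPhi_sub_lerchExpansion hN (hζ.trans_lt hρ) J).norm_le_of_bounded
    (hsummable.hasSum.div_const _) fun n => ?_
  have hnum : ‖-(2 * (n : ℂ) + 1)‖ = 2 * n + 1 := by
    rw [norm_neg]
    exact_mod_cast Complex.norm_natCast (2 * n + 1)
  have hden : ‖(N : ℂ) + (2 * n + 1)‖ = N + (2 * n + 1) := by
    exact_mod_cast Complex.norm_natCast (N + (2 * n + 1))
  calc ‖2 * ζ ^ n * ((-(2 * n + 1)) ^ J / (N ^ J * (N + (2 * n + 1))))‖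
      = 2 * ((2 * n + 1 : ℝ) ^ J * ‖ζ‖ ^ n) / (N ^ J * (N + (2 * n + 1))) := by
        rw [norm_mul, norm_mul, norm_div, norm_mul, norm_pow, norm_pow, norm_pow, hnum, hden,
          Complex.norm_natCast, Complex.norm_ofNat]
        ring
    _ ≤ 2 * ((2 * n + 1 : ℝ) ^ J * ρ ^ n) / (N : ℝ) ^ (J + 1) := by
        rw [pow_succ (N : ℝ)]
        gcongr
        exact le_add_of_nonneg_right (by positivity)

theorem eulerianBPoly_zero (ζ : ℂ) : eulerianBPoly 0 ζ = 1 := by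
  simp [eulerianBPoly, eulerianB]

theorem coeExpansion_eq_lerchExpansion {N : ℕ} {ζ : ℂ} (hN : 1 ≤ N) (hζ : 1 - ζ ≠ 0) (J : ℕ) :
    coeExpansion J N ζ = 2 * ζ * (1 - ζ)⁻¹ * (-2 * (1 - ζ)⁻¹
      + (1 + ζ) * (1 - ζ)⁻¹ * lerchExpansion J N ζ - N * lerchExpansion (J + 1) N ζ) := by
  have hN' : (N : ℂ) ≠ 0 := Nat.cast_ne_zero.2 (by omega)
  have hζ' : ζ - 1 ≠ 0 := by rwa [← neg_sub, neg_ne_zero]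
  have hinv : (1 - ζ)⁻¹ = -(ζ - 1)⁻¹ := by rw [← inv_neg, neg_sub]
  have hterm : ∀ j, ζ * expansionPoly (j + 1) ζ / (N ^ (j + 1) * (ζ - 1) ^ (j + 1 + 2)) =
      ζ * (ζ - 1)⁻¹ / 2 * ((1 + ζ) * (ζ - 1)⁻¹ * (eulerianBPoly j ζ / (N * (ζ - 1)) ^ (j + 1))
        + N * (eulerianBPoly (j + 1) ζ / (N * (ζ - 1)) ^ (j + 1 + 1))) := by
    intro j
    rw [expansionPoly, mul_pow, mul_pow]
    field_simp
    ring
  rw [coeExpansion, lerchExpansion, lerchExpansion, sum_range_succ', sum_range_succ' _ J, hinv,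
    sum_congr rfl fun j _ => hterm j, ← mul_sum, sum_add_distrib, ← mul_sum, ← mul_sum,
    expansionPoly, eulerianBPoly_zero]
  field_simp
  ring

theorem coeW₂_sub_coeExpansion {N : ℕ} {z₁ z₂ ζ Φ : ℂ} (hN : 1 ≤ N) (hz₁ : ‖z₁‖ < 1)
    (hz₂ : 1 < ‖z₂‖) (hζ : ζ = z₁ / z₂) (hΦ : Φ = lerchPhi (((N : ℂ) + 1) / 2) ζ) (J : ℕ) :
    coeW₂ N z₁ z₂ - coeExpansion J N ζ = 2 * ζ * (1 - ζ)⁻¹ *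
      ((1 + ζ) * (1 - ζ)⁻¹ * (Φ - lerchExpansion J N ζ)
        - N * (Φ - lerchExpansion (J + 1) N ζ)
        + (2 * (1 - ζ)⁻¹ - (1 + ζ) * (1 - ζ)⁻¹ * Φ) * ζ ^ N - Φ * (N * ζ ^ N)) := by
  have hne : 1 - ζ ≠ 0 := hζ ▸ one_sub_ne_zero_of_norm_lt_one (norm_div_lt_one hz₁ hz₂)
  rw [coeExpansion_eq_lerchExpansion hN hne, coeW₂_eq_lerchPhi hz₁ hz₂ hζ, ← hΦ]
  field_simp
  ring

theorem isBigO_lerchPhi (hρ : ρ < 1) :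
    (fun x : ℕ × ℂ => lerchPhi (((x.1 : ℂ) + 1) / 2) x.2) =O[uniformFilter ρ]
      (1 : ℕ × ℂ → ℝ) := by
  have htail := isBigO_lerchPhi_sub_lerchExpansion hρ 0
  simp only [lerchExpansion, range_zero, sum_empty, mul_zero, sub_zero] at htail
  refine htail.trans (.of_bound 1 (eventually_principal.2 fun x hx => ?_))
  simpa using inv_le_one_of_one_le₀ (Nat.one_le_cast.2 hx.1 : (1 : ℝ) ≤ x.1)

theorem isBigO_mul_of_isBigO_one {α : Type*} {l : Filter α} {f g : α → ℂ} {h : α → ℝ}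
    (hf : f =O[l] (1 : α → ℝ)) (hg : g =O[l] h) : (fun x => f x * g x) =O[l] h := by
  simpa only [Pi.one_apply, one_mul] using hf.mul hg

theorem isBigO_expansion_error (hρ₀ : 0 ≤ ρ) (hρ : ρ < 1) (J : ℕ) :
    (fun x : ℕ × ℂ => 2 * x.2 * (1 - x.2)⁻¹ *
      ((1 + x.2) * (1 - x.2)⁻¹ *
          (lerchPhi (((x.1 : ℂ) + 1) / 2) x.2 - lerchExpansion J x.1 x.2)
        - x.1 * (lerchPhi (((x.1 : ℂ) + 1) / 2) x.2 - lerchExpansion (J + 1) x.1 x.2)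
        + (2 * (1 - x.2)⁻¹ - (1 + x.2) * (1 - x.2)⁻¹ * lerchPhi (((x.1 : ℂ) + 1) / 2) x.2) *
          x.2 ^ x.1
        - lerchPhi (((x.1 : ℂ) + 1) / 2) x.2 * (x.1 * x.2 ^ x.1)))
      =O[uniformFilter ρ] fun x => ((x.1 : ℝ) ^ (J + 1))⁻¹ := by
  have hone : ∀ c : ℂ, (fun _ : ℕ × ℂ => c) =O[uniformFilter ρ] (1 : ℕ × ℂ → ℝ) := fun c =>
    isBigO_const_const c one_ne_zero _
  have hζ : (fun x : ℕ × ℂ => x.2) =O[uniformFilter ρ] (1 : ℕ × ℂ → ℝ) :=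
    .of_bound ρ (eventually_principal.2 fun x hx => by simpa using hx.2)
  have hu := isBigO_inv_one_sub hρ
  have hΦ := isBigO_lerchPhi hρ
  have hv := isBigO_mul_of_isBigO_one ((hone 1).add hζ) hu
  have htail := isBigO_lerchPhi_sub_lerchExpansion hρ
  refine isBigO_mul_of_isBigO_one (isBigO_mul_of_isBigO_one (hζ.const_mul_left 2) hu) ?_
  refine (((isBigO_mul_of_isBigO_one hv (htail J)).sub (isBigO_natCast_mul (htail (J + 1)))).add
    (isBigO_mul_of_isBigO_one ((hu.const_mul_left 2).sub (isBigO_mul_of_isBigO_one hv hΦ))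
      (isBigO_snd_pow_fst hρ₀ hρ (J + 1)))).sub
    (isBigO_mul_of_isBigO_one hΦ (isBigO_natCast_mul (isBigO_snd_pow_fst hρ₀ hρ (J + 2))))

end UniformBounds

theorem norm_div_le_of_norm_lt {δ : ℝ} (hδ : 0 < δ) {z₁ z₂ : ℂ} (hz₁ : ‖z₁‖ < 1 - δ)
    (hz₂ : 1 + δ < ‖z₂‖) : ‖z₁ / z₂‖ ≤ (1 - δ) / (1 + δ) := by
  rw [norm_div]
  exact div_le_div₀ ((norm_nonneg z₁).trans hz₁.le) hz₁.le (by positivity) hz₂.le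

end CircularEnsemble

theorem proposition5p4_general :
    (∀ (N : ℕ) (z₁ z₂ : ℂ), ‖z₁‖ < 1 → 1 < ‖z₂‖ →
      CircularEnsemble.coeW₂ N z₁ z₂ = CircularEnsemble.coeExact N (z₁ / z₂)) ∧
    (∀ (J : ℕ) (ρ : ℝ), ρ < 1 → ∃ C : ℝ, ∀ N : ℕ, 1 ≤ N →
      ∀ z₁ z₂ : ℂ, ‖z₁‖ < 1 → 1 < ‖z₂‖ → ‖z₁ / z₂‖ ≤ ρ →
        ‖CircularEnsemble.coeW₂ N z₁ z₂ - CircularEnsemble.coeExpansion J N (z₁ / z₂)‖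
          ≤ C / (N : ℝ) ^ (J + 1)) := by
  refine ⟨fun N z₁ z₂ => CircularEnsemble.coeW₂_eq_coeExact, fun J ρ hρ => ?_⟩
  obtain ⟨C, hC⟩ := CircularEnsemble.isBigO_uniformFilter.1
    (CircularEnsemble.isBigO_expansion_error (le_max_right ρ 0) (max_lt hρ one_pos) J)
  refine ⟨C, fun N hN z₁ z₂ hz₁ hz₂ hζ => ?_⟩
  rw [CircularEnsemble.coeW₂_sub_coeExpansion hN hz₁ hz₂ rfl rfl]
  exact hC N (z₁ / z₂) hN (hζ.trans (le_max_left ρ 0))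

theorem proposition5p4 :
    (∀ N : ℕ, 1 ≤ N → ∀ z₁ z₂ : ℂ, ‖z₁‖ < 1 → 1 < ‖z₂‖ →
      CircularEnsemble.coeW₂ N z₁ z₂ = CircularEnsemble.coeExact N (z₁ / z₂)) ∧
    (∀ δ : ℝ, 0 < δ → δ < 1 → ∃ C : ℝ, ∀ N : ℕ, 1 ≤ N →
      ∀ z₁ z₂ : ℂ, ‖z₁‖ < 1 - δ → 1 + δ < ‖z₂‖ →
        ‖CircularEnsemble.coeW₂ N z₁ z₂ - CircularEnsemble.coeGlobalExpansion N (z₁ / z₂)‖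
          ≤ C / (N : ℝ) ^ 10) := by
  refine ⟨fun N _ => proposition5p4_general.1 N, fun δ hδ _ => ?_⟩
  have hρ : (1 - δ) / (1 + δ) < 1 := (div_lt_one (by linarith)).2 (by linarith)
  obtain ⟨C, hC⟩ := proposition5p4_general.2 9 _ hρ
  refine ⟨C, fun N hN z₁ z₂ hz₁ hz₂ => ?_⟩
  rw [← CircularEnsemble.coeExpansion_nine]
  exact hC N hN z₁ z₂ (by linarith) (by linarith)
    (CircularEnsemble.norm_div_le_of_norm_lt hδ hz₁ hz₂)
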